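/- Work over $\mathbb{C}$. Let $\ell_1,\ell_2,\ell_3\in\mathbb{C}[x_0,x_1,x_2]$ be linear forms and $g\in\mathbb{C}[x_0,x_1,x_2]$ a cubic form such that the cubic threefold $$X=V\bigl(\ell_1x_3^2+\ell_2x_4^2+2\ell_3x_3x_4+g\bigr)\subset\mathbb{P}^4$$ is smooth; this is the normal form of a smooth cubic threefold with an involution $\tau:[x_0,\dots,x_4]\mapsto[x_0,x_1,x_2,-x_3,-x_4]$ of non-Eckardt type. Let $L=V(x_0,x_1,x_2)\subset X$ be the line fixed pointwise by $\tau$, let $\pi_L:\mathrm{Bl}_LX\to\mathbb{P}^2_{x_0,x_1,x_2}$ be the conic fibration given by projection from $L$ (where $\mathrm{Bl}_LX$ is the strict transform of $X$ in $\mathrm{Bl}_L\mathbb{P}^4\subset\mathbb{P}^4\times\mathbb{P}^2$), and let $D_L\subset\mathbb{P}^2$ be its discriminant curve, the vanishing locus of the determinant of $$M=\begin{pmatrix}\ell_1&\ell_3&0\\ \ell_3&\ell_2&0\\ 0&0&g\end{pmatrix}.$$ Put $C=V(g)$ and $Q=V(\ell_1\ell_2-\ell_3^2)$ in $\mathbb{P}^2$.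 The discriminant double cover of $D_L$ is $$\widetilde D_L=\{(p,m): p\in D_L,\ m \text{ a line contained in the fibre } \pi_L^{-1}(p)\}\longrightarrow D_L .$$ Let $\pi:\widetilde C\to C$ be its restriction to $C$, where $\widetilde C=\{(p,m)\in\widetilde D_L: p\in C\}$ is regarded as a (reduced) variety in $\mathbb{P}^2\times G(2,5)$. Then: 1. $C$ is smooth and $D_L=C\cup Q$. 2. $\pi:\widetilde C\to C$ is a double cover, that is, a finite flat morphism of degree $2$, and its branch points (the points whose fibre does not consist of two points) are exactly the points of $C\cap Q$. 3. The line bundle associated with $\pi$ is $\mathcal{L}=\mathcal{O}_C(1)$: there is an isomorphism of sheaves of $\mathcal{O}_C$-algebras $$\pi_*\mathcal{O}_{\widetilde C}\;\cong\;\mathcal{O}_C\oplus\mathcal{O}_C(-1),$$ where the product of two local sections $t,t'$ of $\mathcal{O}_C(-1)=\mathcal{L}^{-1}$ is $s\,t\,t'\in\mathcal{O}_C$, with $s=(\ell_1\ell_2-\ell_3^2)|_C\in H^0(C,\mathcal{O}_C(2))=H^0(C,\mathcal{L}^{2})$. -/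

import Mathlib

open MvPolynomial
open scoped LinearAlgebra.Projectivization Topology

/-! ### Complex varieties in homogeneous coordinates

A variety is a set of points with (multi)homogeneous coordinates. Its Zariski topology, its sheaf of
regular functions and its sheaves `𝒪(d)` are the classical ones: local quotients of homogeneous
polynomials in the coordinates. -/

/-- (Multi)homogeneous coordinates, indexed by `σ` and graded by `M`, on a set of points `Y`:
`cone y` is the set of all coordinate vectors of the point `y`. -/
structure HomCoords (Y σ M : Type) where
  wt : σ → M
  cone : Y → Set (σ → ℂ)

namespace HomCoords

variable {Y σ M Y' σ' M' : Type}

/-- The coordinates induced on a subset. -/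
def restrict (H : HomCoords Y σ M) (S : Set Y) : HomCoords S σ M where
  wt := H.wt
  cone y := H.cone y.1

/-- The product of two varieties, with its multihomogeneous coordinates. -/
def prod [Zero M] [Zero M'] (H : HomCoords Y σ M) (H' : HomCoords Y' σ' M') :
    HomCoords (Y × Y') (σ ⊕ σ') (M × M') where
  wt := Sum.elim (fun i => (H.wt i, 0)) (fun j => (0, H'.wt j))
  cone y := {z | (fun i => z (Sum.inl i)) ∈ H.cone y.1 ∧ (fun j => z (Sum.inr j)) ∈ H'.cone y.2}

/-- The Zariski topology: the non-vanishing loci of homogeneous polynomials generate the opens. -/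
abbrev zariski [AddCommGroup M] (H : HomCoords Y σ M) : TopologicalSpace Y :=
  TopologicalSpace.generateFrom
    {D | ∃ (k : M) (B : MvPolynomial σ ℂ), IsWeightedHomogeneous H.wt B k ∧
      D = {y | ∀ x ∈ H.cone y, eval x B ≠ 0}}

/-- The cone over `V`: points of `V` together with one of their coordinate vectors. -/
abbrev ConeOver (H : HomCoords Y σ M) (V : Set Y) : Type := Σ y : V, H.cone y.1

/-- Sections of `𝒪(d)` over `V`: functions on the cone over `V` which locally are quotients `A / B`
of homogeneous polynomials with `deg A = deg B + d`. -/
def sections [AddCommGroup M] (H : HomCoords Y σ M) (d : M) (V : Set Y) :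
    Submodule ℂ (H.ConeOver V → ℂ) where
  carrier := {s | ∀ y : V, ∃ (k : M) (A B : MvPolynomial σ ℂ),
    IsWeightedHomogeneous H.wt A (k + d) ∧ IsWeightedHomogeneous H.wt B k ∧
    (∀ x ∈ H.cone y.1, eval x B ≠ 0) ∧
    ∀ z : H.ConeOver V, eval z.2.1 B ≠ 0 → s z = eval z.2.1 A / eval z.2.1 B}
  zero_mem' := fun y => ⟨0, 0, 1, isWeightedHomogeneous_zero _ _ _,
    isWeightedHomogeneous_one _ _, by simp, by simp⟩
  add_mem' := by
    intro s t hs ht y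
    obtain ⟨k, A, B, hA, hB, h0, h⟩ := hs y
    obtain ⟨k', A', B', hA', hB', h0', h'⟩ := ht y
    refine ⟨k + k', A * B' + A' * B, B * B', ?_, hB.mul hB', ?_, ?_⟩
    · refine IsWeightedHomogeneous.add ?_ ?_
      · have := hA.mul hB'
        rwa [show k + d + k' = k + k' + d by abel] at this
      · have := hA'.mul hB
        rwa [show k' + d + k = k + k' + d by abel] at this
    · intro x hx
      simpa using ⟨h0 x hx, h0' x hx⟩
    · intro z hz
      have hz1 : eval z.2.1 B ≠ 0 := fun e => hz (by simp [e])
      have hz2 : eval z.2.1 B' ≠ 0 := fun e => hz (by simp [e])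
      simp only [Pi.add_apply, h z hz1, h' z hz2, map_add, map_mul]
      field_simp
  smul_mem' := by
    intro c s hs y
    obtain ⟨k, A, B, hA, hB, h0, h⟩ := hs y
    refine ⟨k, C c * A, B, ?_, hB, h0, ?_⟩
    · have := (isWeightedHomogeneous_C H.wt c).mul hA
      rwa [zero_add] at this
    · intro z hz
      simp only [Pi.smul_apply, h z hz, map_mul, eval_C, smul_eq_mul, mul_div_assoc]

/-- The `ℂ`-algebra of regular functions on `V`: functions on points that are sections of `𝒪(0)`. -/
def regular [AddCommGroup M] (H : HomCoords Y σ M) (V : Set Y) : Subalgebra ℂ (V → ℂ) where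
  carrier := {f | (fun z : H.ConeOver V => f z.1) ∈ H.sections 0 V}
  add_mem' := fun {f g} hf hg => (H.sections 0 V).add_mem hf hg
  mul_mem' := by
    intro f g hf hg y
    obtain ⟨k, A, B, hA, hB, h0, h⟩ := hf y
    obtain ⟨k', A', B', hA', hB', h0', h'⟩ := hg y
    refine ⟨k + k', A * A', B * B', ?_, hB.mul hB', ?_, ?_⟩
    · have := hA.mul hA'
      rwa [show k + 0 + (k' + 0) = k + k' + 0 by abel] at this
    · intro x hx
      simpa using ⟨h0 x hx, h0' x hx⟩
    · intro z hz
      have hz1 : eval z.2.1 B ≠ 0 := fun e => hz (by simp [e])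
      have hz2 : eval z.2.1 B' ≠ 0 := fun e => hz (by simp [e])
      have e1 := h z hz1
      have e2 := h' z hz2
      simp only [Pi.mul_apply, map_mul] at e1 e2 ⊢
      rw [e1, e2, div_mul_div_comm]
  algebraMap_mem' := fun c y => ⟨0, C c, 1, by
    rw [add_zero]; exact isWeightedHomogeneous_C H.wt c,
    isWeightedHomogeneous_one _ _, by simp, by intro z _; simp⟩

/-- Morphisms of varieties: continuous maps that pull regular functions back to regular functions. -/
def IsMorphism [AddCommGroup M] [AddCommGroup M'] (H : HomCoords Y σ M) (H' : HomCoords Y' σ' M')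
    (f : Y → Y') : Prop :=
  Continuous[H.zariski, H'.zariski] f ∧
    ∀ V : Set Y', IsOpen[H'.zariski] V → ∀ h ∈ H'.regular V,
      (fun y : f ⁻¹' V => h ⟨f y.1, y.2⟩) ∈ H.regular (f ⁻¹' V)

/-- Affine space `𝔸ⁿ` (all coordinates have weight zero). -/
def affineSpace (n : ℕ) : HomCoords (Fin n → ℂ) (Fin n) ℤ where
  wt := fun _ => 0
  cone y := {y}

/-- A variety is affine if it is isomorphic to a closed subvariety of some `𝔸ⁿ`. -/
def IsAffine [AddCommGroup M] (H : HomCoords Y σ M) : Prop :=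
  ∃ (n : ℕ) (Z : Set (Fin n → ℂ)), IsClosed[(affineSpace n).zariski] Z ∧
    ∃ e : Y ≃ Z, IsMorphism H ((affineSpace n).restrict Z) e ∧
      IsMorphism ((affineSpace n).restrict Z) H e.symm

/-- Projective space `ℙⁿ⁻¹` with its `n` homogeneous coordinates. -/
def projSpace (n : ℕ) : HomCoords (ℙ ℂ (Fin n → ℂ)) (Fin n) ℤ where
  wt := fun _ => 1
  cone p := {x | x ≠ 0 ∧ x ∈ p.submodule}

/-- A double cover: a finite flat morphism of degree two, that is, locally on the base an affine
morphism such that `π_* 𝒪` is a free module of rank two. -/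
def IsDoubleCover [AddCommGroup M] [AddCommGroup M'] (H : HomCoords Y σ M)
    (H' : HomCoords Y' σ' M') (π : Y → Y') : Prop :=
  IsMorphism H H' π ∧ ∀ p : Y', ∃ V : Set Y', p ∈ V ∧ IsOpen[H'.zariski] V ∧
    IsAffine (H'.restrict V) ∧ IsAffine (H.restrict (π ⁻¹' V)) ∧
    ∃ e₁ ∈ H.regular (π ⁻¹' V), ∃ e₂ ∈ H.regular (π ⁻¹' V), ∀ h ∈ H.regular (π ⁻¹' V),
      ∃! ab : H'.regular V × H'.regular V, ∀ y : (π ⁻¹' V : Set Y),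
        h y = ab.1.1 ⟨π y.1, y.2⟩ * e₁ y + ab.2.1 ⟨π y.1, y.2⟩ * e₂ y

/-- An isomorphism of sheaves of `𝒪`-algebras `π_* 𝒪_Y ≅ 𝒪 ⊕ 𝓛⁻¹` over the base `Y'`, where
`𝓛 = 𝒪(d)` and where the product of two sections of `𝓛⁻¹` is `t · t' = s t t'` for a given global
section `s` of `𝓛²`. It is given by its restriction `φ` to the summand `𝓛⁻¹ = 𝒪(-d)`. -/
structure Splitting [AddCommGroup M] [AddCommGroup M'] (H : HomCoords Y σ M)
    (H' : HomCoords Y' σ' M') (π : Y → Y') (d : M') (s : H'.sections (d + d) Set.univ) where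
  φ : ∀ V : Set Y', IsOpen[H'.zariski] V → (H'.sections (-d) V →ₗ[ℂ] H.regular (π ⁻¹' V))
  /-- compatibility with restriction to smaller open sets -/
  restriction : ∀ (V W : Set Y') (hV : IsOpen[H'.zariski] V) (hW : IsOpen[H'.zariski] W)
    (hWV : W ⊆ V) (t : H'.sections (-d) V) (t' : H'.sections (-d) W),
    (∀ z : H'.ConeOver W, t'.1 z = t.1 ⟨⟨z.1.1, hWV z.1.2⟩, z.2⟩) →
    ∀ y : (π ⁻¹' W : Set Y), (φ W hW t').1 y = (φ V hV t).1 ⟨y.1, hWV y.2⟩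
  /-- linearity over the regular functions of the base -/
  linear : ∀ (V : Set Y') (hV : IsOpen[H'.zariski] V) (f : H'.regular V)
    (t t' : H'.sections (-d) V), (∀ z : H'.ConeOver V, t'.1 z = f.1 z.1 * t.1 z) →
    ∀ y : (π ⁻¹' V : Set Y), (φ V hV t').1 y = f.1 ⟨π y.1, y.2⟩ * (φ V hV t).1 y
  /-- the product of two sections of the second summand is given by `s` -/
  mul : ∀ (V : Set Y') (hV : IsOpen[H'.zariski] V) (t t' : H'.sections (-d) V)
    (y : (π ⁻¹' V : Set Y)) (x : H'.cone (π y.1)),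
    (φ V hV t).1 y * (φ V hV t').1 y =
      s.1 ⟨⟨π y.1, trivial⟩, x⟩ * t.1 ⟨⟨π y.1, y.2⟩, x⟩ * t'.1 ⟨⟨π y.1, y.2⟩, x⟩
  /-- `𝒪 ⊕ 𝓛⁻¹ → π_* 𝒪_Y` is bijective -/
  bijective : ∀ (V : Set Y') (hV : IsOpen[H'.zariski] V), ∀ h ∈ H.regular (π ⁻¹' V),
    ∃! ft : H'.regular V × H'.sections (-d) V, ∀ y : (π ⁻¹' V : Set Y),
      h y = ft.1.1 ⟨π y.1, y.2⟩ + (φ V hV ft.2).1 y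

/-- The double cover `π` is associated with the line bundle `𝒪(d)` and the section `s` of its
square. -/
def IsAssociatedWith [AddCommGroup M] [AddCommGroup M'] (H : HomCoords Y σ M)
    (H' : HomCoords Y' σ' M') (π : Y → Y') (d : M') (s : H'.sections (d + d) Set.univ) : Prop :=
  Nonempty (Splitting H H' π d s)

end HomCoords

/-- The branch points of a double cover: the points whose fibre does not have two points. -/
def branchLocus {Y Y' : Type} (π : Y → Y') : Set Y' := {p | (π ⁻¹' {p}).ncard ≠ 2}

/-- The hypersurface in projective space defined by a homogeneous polynomial. -/
def hypersurface {n : ℕ} (P : MvPolynomial (Fin n) ℂ) : Set (ℙ ℂ (Fin n → ℂ)) :=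
  {p | ∀ x ∈ p.submodule, eval x P = 0}

/-- The Jacobian criterion for a projective hypersurface. -/
def IsSmoothHypersurface {n : ℕ} (P : MvPolynomial (Fin n) ℂ) : Prop :=
  ∀ x : Fin n → ℂ, x ≠ 0 → eval x P = 0 → ∃ i, eval x (pderiv i P) ≠ 0

/-- The lines in `ℙ⁴`. -/
abbrev LineP4 : Type := {m : Submodule ℂ (Fin 5 → ℂ) // Module.finrank ℂ m = 2}

/-- The Grassmannian of lines in `ℙ⁴` with its Plücker coordinates. -/
def grassmannian : HomCoords LineP4 (Fin 5 × Fin 5) ℤ where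
  wt := fun _ => 1
  cone m := {ω | ∃ v w : Fin 5 → ℂ, LinearIndependent ℂ ![v, w] ∧
    Submodule.span ℂ {v, w} = m.1 ∧ ω = fun ij => v ij.1 * w ij.2 - v ij.2 * w ij.1}

section ProjectionFromLine

/-- The first three of five coordinates: the linear projection from the line
`L = V(x₀, x₁, x₂) ⊂ ℙ⁴` to the plane `Π = V(x₃, x₄)` with coordinates `x₀, x₁, x₂`. -/
def projL (x : Fin 5 → ℂ) : Fin 3 → ℂ := fun i => x (Fin.castLE (by norm_num) i)

/-- The blow-up along `L` of a subset `X` of `ℙ⁴`: the strict transform of `X` in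
`Bl_L ℙ⁴ = {(x, p) ∈ ℙ⁴ × ℙ² | projL x ∈ p}`, that is, the closure of the preimage of `X \ L`. -/
def blowUpL (X : Set (ℙ ℂ (Fin 5 → ℂ))) : Set (ℙ ℂ (Fin 5 → ℂ) × ℙ ℂ (Fin 3 → ℂ)) :=
  @closure _ ((HomCoords.projSpace 5).prod (HomCoords.projSpace 3)).zariski
    {z | z.1 ∈ X ∧ (∃ x ∈ z.1.submodule, projL x ≠ 0) ∧
      ∀ x ∈ z.1.submodule, projL x ∈ z.2.submodule}

variable (l₁ l₂ l₃ g : MvPolynomial (Fin 3) ℂ)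

/-- `l₁ x₃² + l₂ x₄² + 2 l₃ x₃ x₄ + g`, with `l₁, l₂, l₃, g` polynomials in `x₀, x₁, x₂`. -/
noncomputable def threefoldEq : MvPolynomial (Fin 5) ℂ :=
  rename (Fin.castLE (by norm_num)) l₁ * X 3 ^ 2 + rename (Fin.castLE (by norm_num)) l₂ * X 4 ^ 2 +
    2 * rename (Fin.castLE (by norm_num)) l₃ * X 3 * X 4 + rename (Fin.castLE (by norm_num)) g

/-- The symmetric matrix of the conic fibration `Bl_L X → ℙ²`. -/
noncomputable def conicMatrix : Matrix (Fin 3) (Fin 3) (MvPolynomial (Fin 3) ℂ) :=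
  !![l₁, l₃, 0; l₃, l₂, 0; 0, 0, g]

/-- The discriminant curve `D_L` of the conic fibration. -/
noncomputable def discriminantCurve : Set (ℙ ℂ (Fin 3 → ℂ)) :=
  hypersurface (conicMatrix l₁ l₂ l₃ g).det

/-- The discriminant double cover: pairs of a point `p` of `D_L` and a line contained in the fibre
over `p` of the conic fibration `Bl_L X → ℙ²` (which is a conic in the plane spanned by `L` and
`p`). -/
noncomputable def discriminantCover : Set (ℙ ℂ (Fin 3 → ℂ) × LineP4) :=
  {z | z.1 ∈ discriminantCurve l₁ l₂ l₃ g ∧ ∀ x : ℙ ℂ (Fin 5 → ℂ), x.submodule ≤ z.2.1 →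
    (x, z.1) ∈ blowUpL (hypersurface (threefoldEq l₁ l₂ l₃ g))}

/-- The part `C̃` of the discriminant double cover lying over the cubic `C = V(g)`. -/
noncomputable def coverOfCubic : Set (ℙ ℂ (Fin 3 → ℂ) × LineP4) :=
  {z | z ∈ discriminantCover l₁ l₂ l₃ g ∧ z.1 ∈ hypersurface g}

/-- The variety `C̃`, a subvariety of `ℙ² × G(2, 5)`. -/
noncomputable def coverOfCubicCoords :
    HomCoords (coverOfCubic l₁ l₂ l₃ g) (Fin 3 ⊕ Fin 5 × Fin 5) (ℤ × ℤ) :=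
  ((HomCoords.projSpace 3).prod grassmannian).restrict (coverOfCubic l₁ l₂ l₃ g)

/-- The plane curve `C = V(g)` as a variety. -/
noncomputable def cubicCoords : HomCoords (hypersurface g) (Fin 3) ℤ :=
  (HomCoords.projSpace 3).restrict (hypersurface g)

/-- The restriction `π : C̃ → C` of the discriminant double cover. -/
noncomputable def coverMap (z : coverOfCubic l₁ l₂ l₃ g) : hypersurface g := ⟨z.1.1, z.2.2⟩

end ProjectionFromLine

/-! Over a point [a] of C the fibre of the conic fibration is a plane conic that does not involve g:
it is the cone with vertex (a, 0, 0) over the zeros on L of the binary form q_a = l₁u² + l₂v² +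
2l₃uv, with coefficients evaluated at a. Provided q_a ≠ 0, a line in the fibre is spanned by the
vertex and an isotropic vector (u, v) (`exists_isRep`). Isotropy means that the symmetric matrix of
q_a sends (u, v) to a multiple of (v, -u). Writing this multiple as iy gives y² = s := l₁l₂ - l₃²,
and y in turn determines (u, v) up to scale (`IsRep.point_unique`, `exists_point`). Since y scales
like a, the cover is the curve y² = s in the total space of 𝒪(1): the fibres are {y, -y}, branching
happens where s = 0, and functions upstairs are f + y t with t a section of 𝒪(-1).

Smoothness of X gives three facts: C is smooth, q_a ≠ 0 for every [a] in C
(`conic_ne_zero_on_cubic`), and C meets Q transversally (`exists_minor_ne_zero`). If one of them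
failed, X would have a singular point (t a, u, v). Transversality makes C \ Q dense in C near every
point (`mem_closure_cone_diff`). Hence identities obtained off Q by comparing y with -y extend
across the branch points, and irreducibility of C is never needed.

The cover carries two coordinate systems: the Plücker coordinates of the statement and the pair (a,
y). They have the same regular functions (`locallyRational_cover_root`,
`locallyRational_root_cover`). In the coordinates (a, y), denominators are made free of y by
multiplying with the conjugate (`exists_local_splitting`), and the resulting local splittings glue
(`splitting_surjective`, `splitting_injective`). -/

/-! ### Weighted homogeneous polynomials -/

section WeightedHomogeneous

variable {σ τ M N : Type} [AddCommGroup M] [AddCommGroup N]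

/-- A property that holds for constants and variables and is stable under sums and products holds
for all weighted homogeneous polynomials. -/
theorem isWeightedHomogeneous_closure_induction {w : σ → M} {Q : MvPolynomial σ ℂ → M → Prop}
    (zero : ∀ m, Q 0 m) (const : ∀ c, Q (C c) 0) (var : ∀ i, Q (X i) (w i))
    (add : ∀ p q m, Q p m → Q q m → Q (p + q) m)
    (mul : ∀ p q m n, Q p m → Q q n → Q (p * q) (m + n))
    {p : MvPolynomial σ ℂ} {m : M} (hp : IsWeightedHomogeneous w p m) : Q p m := by
  have pow : ∀ i (k : ℕ), Q (X i ^ k) (k • w i) := by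
    intro i k
    induction k with
    | zero => simpa using const 1
    | succ k ih => rw [pow_succ, succ_nsmul]; exact mul _ _ _ _ ih (var i)
  have mon : ∀ (d : σ →₀ ℕ) (c : ℂ), Q (monomial d c) (Finsupp.weight w d) := by
    intro d
    induction d using Finsupp.induction_linear with
    | zero => intro c; simpa using const c
    | add f g hf hg =>
      intro c
      have := mul _ _ _ _ (hf c) (hg 1)
      rwa [monomial_mul, mul_one, ← map_add] at this
    | single i k =>
      intro c
      have := mul _ _ _ _ (const c) (pow i k)
      rwa [C_mul_X_pow_eq_monomial, zero_add, ← Finsupp.weight_single] at this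
  induction hp using IsWeightedHomogeneous.induction_on with
  | zero => exact zero m
  | add p q _ _ h h' => exact add _ _ _ h h'
  | monomial d r hr => exact hr ▸ mon d r

theorem MvPolynomial.IsWeightedHomogeneous.aeval_weighted {w : σ → M} {w' : τ → N} (ψ : M →+ N)
    {P : σ → MvPolynomial τ ℂ} (hP : ∀ i, IsWeightedHomogeneous w' (P i) (ψ (w i)))
    {p : MvPolynomial σ ℂ} {m : M} (hp : IsWeightedHomogeneous w p m) :
    IsWeightedHomogeneous w' (aeval P p) (ψ m) := by
  refine isWeightedHomogeneous_closure_induction (w := w)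
    (Q := fun p m => IsWeightedHomogeneous w' (aeval P p) (ψ m)) ?_ ?_ ?_ ?_ ?_ hp
  · intro m; simpa using isWeightedHomogeneous_zero _ _ _
  · intro c; simpa using isWeightedHomogeneous_C w' c
  · intro i; simpa using hP i
  · intro p q m hp hq; simpa using hp.add hq
  · intro p q m n hp hq; simpa using hp.mul hq

theorem MvPolynomial.IsHomogeneous.isWeightedHomogeneous_const {p : MvPolynomial σ ℂ} {n : ℕ}
    (hp : p.IsHomogeneous n) {w : σ → M} {m : M} (hw : ∀ i, w i = m) :
    IsWeightedHomogeneous w p (n • m) := by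
  intro d hd
  have h := hp hd
  rw [← h, Finsupp.weight_apply, Finsupp.weight_apply, Finsupp.sum, Finsupp.sum, Finset.sum_smul]
  exact Finset.sum_congr rfl fun i _ => by simp [hw]

theorem MvPolynomial.IsHomogeneous.rename_isWeightedHomogeneous {p : MvPolynomial σ ℂ} {n : ℕ}
    (hp : p.IsHomogeneous n) (f : σ → τ) {w : τ → M} {m : M} (hw : ∀ i, w (f i) = m) :
    IsWeightedHomogeneous w (rename f p) (n • m) := by
  have h := hp.isWeightedHomogeneous_const (w := fun _ => m) (m := m) (fun _ => rfl)
  have := h.aeval_weighted (w' := w) (AddMonoidHom.id M) (P := fun i => X (f i))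
    (fun i => by simpa [hw] using isWeightedHomogeneous_X ℂ w (f i))
  rw [rename_eq_aeval]
  exact this

/-- A character of the grading group acts on coordinate vectors through the weights, and weighted
homogeneous polynomials are its eigenvectors. This is why non-vanishing and degree-zero quotients do
not depend on the coordinate vector chosen for a point. -/
theorem MvPolynomial.IsWeightedHomogeneous.eval_torus {w : σ → M} {p : MvPolynomial σ ℂ} {m : M}
    (hp : IsWeightedHomogeneous w p m) (c : Multiplicative M →* ℂˣ) (x : σ → ℂ) :
    eval (fun i => c (Multiplicative.ofAdd (w i)) * x i) p =
      c (Multiplicative.ofAdd m) * eval x p := by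
  refine isWeightedHomogeneous_closure_induction (w := w)
    (Q := fun p m => eval (fun i => c (Multiplicative.ofAdd (w i)) * x i) p =
      c (Multiplicative.ofAdd m) * eval x p) ?_ ?_ ?_ ?_ ?_ hp
  · simp
  · simp
  · simp
  · intro p q m hp hq; simp [hp, hq, mul_add]
  · intro p q m n hp hq; simp only [map_mul, hp, hq, ofAdd_add, Units.val_mul]; ring

theorem isWeightedHomogeneous_of_weight_zero (p : MvPolynomial σ ℂ) :
    IsWeightedHomogeneous (fun _ : σ => (0 : M)) p 0 := by
  intro d _
  simp [Finsupp.weight_apply, Finsupp.sum]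

/-- Clearing denominators after substituting fractions with a common denominator `D` into a
weighted homogeneous polynomial. -/
theorem MvPolynomial.IsWeightedHomogeneous.exists_clear_denominators {w : σ → M} {w' : τ → N}
    {p : MvPolynomial σ ℂ} {m : M} (hp : IsWeightedHomogeneous w p m) (ψ : M →+ N)
    {D : MvPolynomial τ ℂ} {k : N} (hD : IsWeightedHomogeneous w' D k)
    {P : σ → MvPolynomial τ ℂ} (hP : ∀ i, IsWeightedHomogeneous w' (P i) (ψ (w i) + k)) :
    ∃ (n : ℕ) (p' : MvPolynomial τ ℂ), IsWeightedHomogeneous w' p' (ψ m + n • k) ∧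
      ∀ x, eval x D ≠ 0 →
        eval x p' = eval x D ^ n * eval (fun i => eval x (P i) / eval x D) p := by
  refine isWeightedHomogeneous_closure_induction (w := w)
    (Q := fun p m => ∃ (n : ℕ) (p' : MvPolynomial τ ℂ),
      IsWeightedHomogeneous w' p' (ψ m + n • k) ∧ ∀ x, eval x D ≠ 0 →
        eval x p' = eval x D ^ n * eval (fun i => eval x (P i) / eval x D) p) ?_ ?_ ?_ ?_ ?_ hp
  · intro m
    exact ⟨0, 0, isWeightedHomogeneous_zero _ _ _, by simp⟩
  · intro c
    exact ⟨0, C c, by simpa using isWeightedHomogeneous_C w' c, by simp⟩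
  · intro i
    refine ⟨1, P i, by simpa using hP i, fun x hx => ?_⟩
    simp only [eval_X, pow_one]
    field_simp
  · rintro p q m ⟨n, p', hp', h⟩ ⟨n', q', hq', h'⟩
    refine ⟨n + n', p' * D ^ n' + q' * D ^ n, ?_, fun x hx => ?_⟩
    · refine IsWeightedHomogeneous.add ?_ ?_
      · have := hp'.mul (hD.pow n')
        rwa [show ψ m + n • k + n' • k = ψ m + (n + n') • k by rw [add_smul]; abel] at this
      · have := hq'.mul (hD.pow n)
        rwa [show ψ m + n' • k + n • k = ψ m + (n + n') • k by rw [add_smul]; abel] at this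
    · simp only [map_add, map_mul, map_pow, h x hx, h' x hx]
      ring
  · rintro p q m l ⟨n, p', hp', h⟩ ⟨n', q', hq', h'⟩
    refine ⟨n + n', p' * q', ?_, fun x hx => ?_⟩
    · have := hp'.mul hq'
      rwa [show ψ m + n • k + (ψ l + n' • k) = ψ (m + l) + (n + n') • k by
        rw [add_smul, map_add]; abel] at this
    · simp only [map_mul, h x hx, h' x hx]
      ring

end WeightedHomogeneous

/-! ### Morphisms given locally by homogeneous polynomials -/

namespace HomCoords

section Rational

variable {Y σ M Y' σ' M' Y'' σ'' M'' : Type} [AddCommGroup M] [AddCommGroup M'] [AddCommGroup M'']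

/-- Every point has coordinates, and any two coordinate vectors of a point differ by the action of
the grading torus. -/
structure WellFormed (H : HomCoords Y σ M) : Prop where
  nonempty : ∀ y, (H.cone y).Nonempty
  torus : ∀ y, ∀ x ∈ H.cone y, ∀ x' ∈ H.cone y, ∃ c : Multiplicative M →* ℂˣ,
    x' = fun i => c (Multiplicative.ofAdd (H.wt i)) * x i

theorem WellFormed.eval_ne_zero {H : HomCoords Y σ M} (hH : H.WellFormed) {y : Y} {x x' : σ → ℂ}
    (hx : x ∈ H.cone y) (hx' : x' ∈ H.cone y) {B : MvPolynomial σ ℂ} {k : M}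
    (hB : IsWeightedHomogeneous H.wt B k) (h : eval x B ≠ 0) : eval x' B ≠ 0 := by
  obtain ⟨c, rfl⟩ := hH.torus y x hx x' hx'
  rw [hB.eval_torus]
  exact mul_ne_zero (Units.ne_zero _) h

theorem WellFormed.restrict {H : HomCoords Y σ M} (hH : H.WellFormed) (S : Set Y) :
    (H.restrict S).WellFormed :=
  ⟨fun y => hH.nonempty y.1, fun y => hH.torus y.1⟩

theorem WellFormed.prod {H : HomCoords Y σ M} {H' : HomCoords Y' σ' M'} (hH : H.WellFormed)
    (hH' : H'.WellFormed) : (H.prod H').WellFormed := by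
  refine ⟨fun y => ?_, fun y x hx x' hx' => ?_⟩
  · obtain ⟨a, ha⟩ := hH.nonempty y.1
    obtain ⟨b, hb⟩ := hH'.nonempty y.2
    exact ⟨Sum.elim a b, ha, hb⟩
  · obtain ⟨c, hc⟩ := hH.torus y.1 _ hx.1 _ hx'.1
    obtain ⟨c', hc'⟩ := hH'.torus y.2 _ hx.2 _ hx'.2
    refine ⟨(c.comp (AddMonoidHom.fst M M').toMultiplicative) *
      (c'.comp (AddMonoidHom.snd M M').toMultiplicative), funext fun i => ?_⟩
    cases i with
    | inl i => simpa [HomCoords.prod] using congrFun hc i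
    | inr j => simpa [HomCoords.prod] using congrFun hc' j

/-- Coordinates of weight one that are unique up to a common nonzero factor. -/
theorem wellFormed_of_scaling {H : HomCoords Y σ ℤ} (hw : ∀ i, H.wt i = 1)
    (hne : ∀ y, (H.cone y).Nonempty)
    (h : ∀ y, ∀ x ∈ H.cone y, ∀ x' ∈ H.cone y, ∃ c : ℂ, c ≠ 0 ∧ x' = fun i => c * x i) :
    H.WellFormed := by
  refine ⟨hne, fun y x hx x' hx' => ?_⟩
  obtain ⟨c, hc, rfl⟩ := h y x hx x' hx'
  refine ⟨zpowersHom ℂˣ (Units.mk0 c hc), funext fun i => ?_⟩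
  simp [hw, zpowersHom_apply]

theorem isOpen_nonvanishing (H : HomCoords Y σ M) {B : MvPolynomial σ ℂ} {k : M}
    (hB : IsWeightedHomogeneous H.wt B k) : IsOpen[H.zariski] {y | ∀ x ∈ H.cone y, eval x B ≠ 0} :=
  TopologicalSpace.isOpen_generateFrom_of_mem ⟨k, B, hB, rfl⟩

/-- The complement asks for non-vanishing at some coordinate vector, the generating open sets ask
for it at all of them; `WellFormed` makes the two conditions agree. -/
theorem WellFormed.isClosed_vanishing {H : HomCoords Y σ M} (hH : H.WellFormed)
    {B : MvPolynomial σ ℂ} {k : M} (hB : IsWeightedHomogeneous H.wt B k) :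
    IsClosed[H.zariski] {y | ∀ x ∈ H.cone y, eval x B = 0} := by
  let _ := H.zariski
  rw [← isOpen_compl_iff]
  convert H.isOpen_nonvanishing hB using 1
  ext y
  simp only [Set.mem_compl_iff, Set.mem_ofPred_eq, not_forall]
  constructor
  · rintro ⟨x, hx, h⟩ x' hx'
    exact hH.eval_ne_zero hx hx' hB h
  · intro h
    obtain ⟨x, hx⟩ := hH.nonempty y
    exact ⟨x, hx, h x hx⟩

theorem isTopologicalBasis_nonvanishing (H : HomCoords Y σ M) :
    @TopologicalSpace.IsTopologicalBasis Y H.zariski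
      {D | ∃ (k : M) (B : MvPolynomial σ ℂ), IsWeightedHomogeneous H.wt B k ∧
        D = {y | ∀ x ∈ H.cone y, eval x B ≠ 0}} := by
  let _ := H.zariski
  refine ⟨?_, ?_, rfl⟩
  · rintro _ ⟨k, B, hB, rfl⟩ _ ⟨k', B', hB', rfl⟩ y hy
    refine ⟨_, ⟨k + k', B * B', hB.mul hB', rfl⟩, ?_, ?_⟩
    · intro x hx
      simpa using ⟨hy.1 x hx, hy.2 x hx⟩
    · intro y' hy'
      have : ∀ x ∈ H.cone y', eval x B ≠ 0 ∧ eval x B' ≠ 0 := fun x hx => by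
        simpa using hy' x hx
      exact ⟨fun x hx => (this x hx).1, fun x hx => (this x hx).2⟩
  · refine Set.eq_univ_of_univ_subset fun y _ => ?_
    exact ⟨_, ⟨0, 1, isWeightedHomogeneous_one _ _, rfl⟩, by simp⟩

/-- Inside an open set, every point has a neighbourhood which is a non-vanishing locus. -/
theorem exists_nonvanishing_subset (H : HomCoords Y σ M) {V : Set Y} (hV : IsOpen[H.zariski] V)
    {y : Y} (hy : y ∈ V) : ∃ (k : M) (B : MvPolynomial σ ℂ), IsWeightedHomogeneous H.wt B k ∧
      (∀ x ∈ H.cone y, eval x B ≠ 0) ∧ ∀ y', (∀ x ∈ H.cone y', eval x B ≠ 0) → y' ∈ V := by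
  let _ := H.zariski
  obtain ⟨_, ⟨k, B, hB, rfl⟩, h1, h2⟩ :=
    H.isTopologicalBasis_nonvanishing.exists_subset_of_mem_open hy hV
  exact ⟨k, B, hB, h1, fun y' hy' => h2 hy'⟩

/-- A map which locally is given by quotients of homogeneous polynomials with a common
denominator, compatibly with the gradings. -/
def LocallyRational (H : HomCoords Y σ M) (H' : HomCoords Y' σ' M') (f : Y → Y') : Prop :=
  ∃ ψ : M' →+ M, ∀ y₀, ∃ (k : M) (D : MvPolynomial σ ℂ) (P : σ' → MvPolynomial σ ℂ),
    IsWeightedHomogeneous H.wt D k ∧ (∀ j, IsWeightedHomogeneous H.wt (P j) (ψ (H'.wt j) + k)) ∧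
    (∀ x ∈ H.cone y₀, eval x D ≠ 0) ∧
    ∀ y, ∀ x ∈ H.cone y, eval x D ≠ 0 → (fun j => eval x (P j) / eval x D) ∈ H'.cone (f y)

theorem LocallyRational.restrict {H : HomCoords Y σ M} {H' : HomCoords Y' σ' M'} {f : Y → Y'}
    (hf : LocallyRational H H' f) {S : Set Y} {S' : Set Y'} (h : ∀ y ∈ S, f y ∈ S') :
    LocallyRational (H.restrict S) (H'.restrict S') (fun y => ⟨f y.1, h y.1 y.2⟩) := by
  obtain ⟨ψ, hf⟩ := hf
  refine ⟨ψ, fun y₀ => ?_⟩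
  obtain ⟨k, D, P, hD, hP, h0, h1⟩ := hf y₀.1
  exact ⟨k, D, P, hD, hP, h0, fun y => h1 y.1⟩

/-- Substituting the local quotients into a homogeneous polynomial and clearing the common
denominator D gives a homogeneous polynomial upstairs, so basic open sets and local quotients both
pull back. -/
theorem LocallyRational.isMorphism {H : HomCoords Y σ M} {H' : HomCoords Y' σ' M'} {f : Y → Y'}
    (hH : H.WellFormed) (hH' : H'.WellFormed) (hf : LocallyRational H H' f) :
    IsMorphism H H' f := by
  obtain ⟨ψ, hf⟩ := hf
  constructor
  · let _ := H.zariski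
    refine continuous_generateFrom_iff.2 ?_
    rintro _ ⟨m, B, hB, rfl⟩
    refine isOpen_iff_forall_mem_open.2 fun y₀ hy₀ => ?_
    obtain ⟨k, D, P, hD, hP, h0, h1⟩ := hf y₀
    obtain ⟨n, B', hB', hBe⟩ := hB.exists_clear_denominators ψ hD hP
    refine ⟨_, ?_, H.isOpen_nonvanishing (hD.mul hB'), ?_⟩
    · intro y hy x' hx'
      obtain ⟨x, hx⟩ := hH.nonempty y
      have h2 := hy x hx
      rw [map_mul] at h2
      have hDx := left_ne_zero_of_mul h2
      have hBx := right_ne_zero_of_mul h2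
      rw [hBe x hDx] at hBx
      exact hH'.eval_ne_zero (h1 y x hx hDx) hx' hB (right_ne_zero_of_mul hBx)
    · intro x hx
      rw [map_mul, hBe x (h0 x hx)]
      exact mul_ne_zero (h0 x hx)
        (mul_ne_zero (pow_ne_zero _ (h0 x hx)) (hy₀ _ (h1 y₀ x hx (h0 x hx))))
  · intro V _ h hh y₀
    obtain ⟨k, D, P, hD, hP, h0, h1⟩ := hf y₀.1
    obtain ⟨m, A, B, hA, hB, hB0, hAB⟩ := hh ⟨f y₀.1, y₀.2⟩
    obtain ⟨n, A', hA', hAe⟩ := hA.exists_clear_denominators ψ hD hP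
    obtain ⟨n', B', hB', hBe⟩ := hB.exists_clear_denominators ψ hD hP
    -- With A = A'/Dⁿ and B = B'/Dⁿ' the quotient is A'Dⁿ'/(B'Dⁿ). The extra factor D ensures D ≠ 0
    -- wherever the new denominator is non-zero, even when n = 0.
    refine ⟨ψ m + n' • k + n • k + k, A' * D ^ n' * D, B' * D ^ n * D, ?_,
      (hB'.mul (hD.pow n)).mul hD, ?_, ?_⟩
    · have := (hA'.mul (hD.pow n')).mul hD
      rwa [show ψ (m + 0) + n • k + n' • k + k = ψ m + n' • k + n • k + k + 0 by
        rw [add_zero, add_zero]; abel] at this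
    · intro x hx
      have hDx := h0 x hx
      simp only [map_mul, map_pow, hBe x hDx]
      exact mul_ne_zero (mul_ne_zero (mul_ne_zero (pow_ne_zero _ hDx)
        (hB0 _ (h1 _ x hx hDx))) (pow_ne_zero _ hDx)) hDx
    · rintro ⟨y, x, hx⟩ hne
      simp only [map_mul, map_pow] at hne ⊢
      have hDx := right_ne_zero_of_mul hne
      rw [hBe x hDx] at hne ⊢
      rw [hAe x hDx]
      have hBx : eval (fun i => eval x (P i) / eval x D) B ≠ 0 := by
        intro e
        simp [e] at hne
      have := hAB ⟨⟨f y.1, y.2⟩, ⟨_, h1 y.1 x hx hDx⟩⟩ hBx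
      simp only at this
      rw [this]
      field_simp

theorem IsMorphism.comp {H : HomCoords Y σ M} {H' : HomCoords Y' σ' M'}
    {H'' : HomCoords Y'' σ'' M''} {f : Y → Y'} {f' : Y' → Y''} (hf' : IsMorphism H' H'' f')
    (hf : IsMorphism H H' f) : IsMorphism H H'' (f' ∘ f) := by
  refine ⟨@Continuous.comp _ _ _ H.zariski H'.zariski H''.zariski _ _ hf'.1 hf.1,
    fun V hV h hh => ?_⟩
  let _ := H'.zariski
  let _ := H''.zariski
  exact hf.2 _ (hV.preimage hf'.1) _ (hf'.2 V hV h hh)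

theorem projSpace_wellFormed (n : ℕ) : (projSpace n).WellFormed := by
  refine wellFormed_of_scaling (fun _ => rfl)
    (fun p => ⟨p.rep, p.rep_nonzero, ?_⟩) fun p x hx x' hx' => ?_
  · rw [Projectivization.submodule_eq]
    exact Submodule.mem_span_singleton_self _
  · have h1 := hx.2
    have h2 := hx'.2
    rw [Projectivization.submodule_eq, Submodule.mem_span_singleton] at h1 h2
    obtain ⟨a, ha⟩ := h1
    obtain ⟨b, hb⟩ := h2
    have ha0 : a ≠ 0 := by
      rintro rfl
      exact hx.1 (by simpa using ha.symm)
    have hb0 : b ≠ 0 := by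
      rintro rfl
      exact hx'.1 (by simpa using hb.symm)
    refine ⟨b / a, div_ne_zero hb0 ha0, ?_⟩
    rw [← ha, ← hb]
    funext i
    simp only [Pi.smul_apply, smul_eq_mul]
    field_simp

theorem affineSpace_wellFormed (n : ℕ) : (affineSpace n).WellFormed := by
  refine ⟨fun y => ⟨y, rfl⟩, fun y x hx x' hx' => ⟨1, ?_⟩⟩
  rw [show x = y from hx, show x' = y from hx']
  simp

/-- A change of basis of the plane multiplies all Plücker coordinates by its determinant. -/
theorem grassmannian_wellFormed : grassmannian.WellFormed := by
  refine wellFormed_of_scaling (fun _ => rfl) (fun m => ?_) fun m => ?_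
  · obtain ⟨m, hm⟩ := m
    let b := Module.finBasisOfFinrankEq ℂ m hm
    have hb := b.linearIndependent.map' m.subtype (by simp)
    refine ⟨_, b 0, b 1, ?_, ?_, rfl⟩
    · rwa [show ![(b 0 : Fin 5 → ℂ), b 1] = m.subtype ∘ b from
        funext fun i => by fin_cases i <;> rfl]
    · have := b.span_eq
      have h2 := congrArg (Submodule.map m.subtype) this
      rw [Submodule.map_span, ← Set.range_comp, Submodule.map_top, Submodule.range_subtype] at h2
      convert h2 using 2
      ext x
      simp [Fin.exists_fin_two, eq_comm]
  · rintro _ ⟨v, w, hli, hs, rfl⟩ _ ⟨v', w', hli', hs', rfl⟩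
    have hv : v' ∈ Submodule.span ℂ {v, w} := by
      rw [hs, ← hs']; exact Submodule.subset_span (by simp)
    have hw : w' ∈ Submodule.span ℂ {v, w} := by
      rw [hs, ← hs']; exact Submodule.subset_span (by simp)
    obtain ⟨a, b, rfl⟩ := Submodule.mem_span_pair.1 hv
    obtain ⟨c, d, rfl⟩ := Submodule.mem_span_pair.1 hw
    refine ⟨a * d - b * c, fun e => ?_, ?_⟩
    · rw [LinearIndependent.pair_iff] at hli'
      have h1 := hli' d (-b) (by
        have : d • (a • v + b • w) + -b • (c • v + d • w) = (a * d - b * c) • v := by module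
        rw [this, e, zero_smul])
      have h2 := hli' c (-a) (by
        have : c • (a • v + b • w) + -a • (c • v + d • w) = -(a * d - b * c) • w := by module
        rw [this, e, neg_zero, zero_smul])
      have := hli' 1 0 (by simp [neg_eq_zero.1 h1.2, neg_eq_zero.1 h2.2])
      exact one_ne_zero this.1
    · funext ij
      simp only [Pi.add_apply, Pi.smul_apply, smul_eq_mul]
      ring

end Rational

end HomCoords

/-! ### Polynomial calculus -/

section Calculus

theorem MvPolynomial.IsHomogeneous.eval_smul_point {σ : Type} {p : MvPolynomial σ ℂ} {n : ℕ}
    (hp : p.IsHomogeneous n) (c : ℂ) (x : σ → ℂ) : eval (c • x) p = c ^ n * eval x p := by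
  induction hp using IsWeightedHomogeneous.induction_on with
  | zero => simp
  | add p q _ _ h h' => rw [map_add, map_add, h, h', mul_add]
  | monomial d r hr =>
    simp only [eval_monomial, Finsupp.prod, Pi.smul_apply, smul_eq_mul, mul_pow,
      Finset.prod_mul_distrib, Finset.prod_pow_eq_pow_sum]
    rw [← hr, Finsupp.weight_apply, Finsupp.sum]
    simp only [Pi.one_apply, smul_eq_mul, mul_one]
    ring

theorem MvPolynomial.IsHomogeneous.eval_pderiv_const {σ : Type} {l : MvPolynomial σ ℂ}
    (hl : l.IsHomogeneous 1) (i : σ) (x y : σ → ℂ) :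
    eval x (pderiv i l) = eval y (pderiv i l) := by
  have h : (pderiv i l).IsHomogeneous 0 := hl.pderiv
  rw [← totalDegree_zero_iff_isHomogeneous, totalDegree_eq_zero_iff_eq_C] at h
  rw [h, eval_C, eval_C]

theorem MvPolynomial.IsHomogeneous.eval_euler {n : ℕ} {p : MvPolynomial (Fin 3) ℂ}
    (hp : p.IsHomogeneous n) (x : Fin 3 → ℂ) :
    x 0 * eval x (pderiv 0 p) + x 1 * eval x (pderiv 1 p) + x 2 * eval x (pderiv 2 p) =
      n * eval x p := by
  have := congrArg (eval x) hp.sum_X_mul_pderiv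
  simpa [Fin.sum_univ_three] using this

theorem MvPolynomial.exists_hasStrictFDerivAt_eval {σ : Type} [Fintype σ] (p : MvPolynomial σ ℂ)
    (x : σ → ℂ) : ∃ f' : (σ → ℂ) →L[ℂ] ℂ, HasStrictFDerivAt (fun x => eval x p) f' x ∧
      ∀ v, f' v = ∑ i, eval x (pderiv i p) * v i := by
  classical
  induction p using MvPolynomial.induction_on with
  | C c => exact ⟨0, by simpa using hasStrictFDerivAt_const (𝕜 := ℂ) c x, by simp⟩
  | add p q hp hq =>
    obtain ⟨f, hf, hfe⟩ := hp
    obtain ⟨f', hf', hfe'⟩ := hq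
    refine ⟨f + f', ?_, fun v => ?_⟩
    · simp only [map_add]
      exact hf.add hf'
    · rw [add_apply, hfe, hfe', ← Finset.sum_add_distrib]
      simp [add_mul]
  | mul_X p j hp =>
    obtain ⟨f, hf, hfe⟩ := hp
    have h := hf.mul (hasStrictFDerivAt_apply (𝕜 := ℂ) (F' := fun _ : σ => ℂ) j x)
    refine ⟨(eval x p) • (ContinuousLinearMap.proj j : (σ → ℂ) →L[ℂ] ℂ) + x j • f, ?_,
      fun v => ?_⟩
    · simp only [map_mul, eval_X]
      exact h
    · simp only [add_apply, smul_apply, hfe, ContinuousLinearMap.proj_apply, smul_eq_mul,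
        Derivation.leibniz, pderiv_X, map_add, map_mul, eval_X, add_mul, Finset.sum_add_distrib,
        Finset.mul_sum]
      congr 1
      · rw [Finset.sum_eq_single j]
        · simp
        · intro b _ hb
          simp [hb.symm]
        · simp
      · exact Finset.sum_congr rfl fun i _ => by ring

end Calculus

/-! ### Elementary linear algebra -/

section LinearAlgebra

/-- If all minors of two vectors vanish and one of them is nonzero, the other is a multiple. -/
theorem exists_eq_mul_of_minors {v G : Fin 3 → ℂ} (hG : G ≠ 0)
    (h : ∀ i j, v i * G j = v j * G i) : ∃ c : ℂ, ∀ i, v i = c * G i := by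
  obtain ⟨j, hj⟩ := Function.ne_iff.1 hG
  simp only [Pi.zero_apply] at hj
  refine ⟨v j / G j, fun i => ?_⟩
  field_simp
  exact h i j

/-- Quadratic formula. It supplies the direction (u, v) of a singular point in
`conic_ne_zero_on_cubic`. -/
theorem exists_binary_quadratic_zero (A B D : ℂ) :
    ∃ u v : ℂ, (u ≠ 0 ∨ v ≠ 0) ∧ A * u ^ 2 + B * u * v + D * v ^ 2 = 0 := by
  by_cases hA : A = 0
  · exact ⟨1, 0, by simp, by simp [hA]⟩
  · obtain ⟨r, hr⟩ := IsAlgClosed.exists_eq_mul_self (B ^ 2 - 4 * A * D)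
    refine ⟨-B + r, 2 * A, Or.inr (mul_ne_zero two_ne_zero hA), ?_⟩
    linear_combination (-A) * hr

end LinearAlgebra

/-! ### The smooth threefold -/

section Threefold

/-- The coordinate vector `(a₀, a₁, a₂, u, v)`. -/
def joinVec (a : Fin 3 → ℂ) (u v : ℂ) : Fin 5 → ℂ := ![a 0, a 1, a 2, u, v]

@[simp] theorem joinVec_castLE (a : Fin 3 → ℂ) (u v : ℂ) (h : 3 ≤ 5) (i : Fin 3) :
    joinVec a u v (Fin.castLE h i) = a i := by
  fin_cases i <;> rfl

@[simp] theorem joinVec_three (a : Fin 3 → ℂ) (u v : ℂ) : joinVec a u v 3 = u := rfl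

@[simp] theorem joinVec_four (a : Fin 3 → ℂ) (u v : ℂ) : joinVec a u v 4 = v := rfl

theorem joinVec_comp_castLE (a : Fin 3 → ℂ) (u v : ℂ) (h : 3 ≤ 5) :
    joinVec a u v ∘ Fin.castLE h = a := funext (joinVec_castLE a u v h)

@[simp] theorem projL_joinVec (a : Fin 3 → ℂ) (u v : ℂ) : projL (joinVec a u v) = a :=
  funext (joinVec_castLE a u v _)

theorem joinVec_projL (x : Fin 5 → ℂ) : joinVec (projL x) (x 3) (x 4) = x := by
  funext i
  fin_cases i <;> rfl

theorem joinVec_ne_zero {a : Fin 3 → ℂ} {u v : ℂ} (h : a ≠ 0 ∨ u ≠ 0 ∨ v ≠ 0) :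
    joinVec a u v ≠ 0 := by
  intro e
  have ha : a = 0 := by
    rw [← projL_joinVec a u v, e]
    rfl
  have hu : u = 0 := congrFun e 3
  have hv : v = 0 := congrFun e 4
  simp [ha, hu, hv] at h

theorem eval_joinVec_threefoldEq (l₁ l₂ l₃ g : MvPolynomial (Fin 3) ℂ) (a : Fin 3 → ℂ) (u v : ℂ) :
    eval (joinVec a u v) (threefoldEq l₁ l₂ l₃ g) =
      eval a l₁ * u ^ 2 + eval a l₂ * v ^ 2 + 2 * eval a l₃ * u * v + eval a g := by
  simp [threefoldEq, eval_rename, joinVec_comp_castLE]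

variable {l₁ l₂ l₃ g : MvPolynomial (Fin 3) ℂ}

theorem castLE_range (h : 3 ≤ 5) (i : Fin 5) : (∃ j, i = Fin.castLE h j) ∨ i = 3 ∨ i = 4 := by
  fin_cases i
  · exact Or.inl ⟨0, rfl⟩
  · exact Or.inl ⟨1, rfl⟩
  · exact Or.inl ⟨2, rfl⟩
  · exact Or.inr (Or.inl rfl)
  · exact Or.inr (Or.inr rfl)

theorem castLE_ne {h : 3 ≤ 5} {j : Fin 3} : (3 : Fin 5) ≠ Fin.castLE h j ∧
    (4 : Fin 5) ≠ Fin.castLE h j := by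
  fin_cases j <;> simp [Fin.ext_iff]

theorem pderiv_rename_castLE_eq_zero (h : 3 ≤ 5) {i : Fin 5} (hi : i = 3 ∨ i = 4)
    (p : MvPolynomial (Fin 3) ℂ) : pderiv i (rename (Fin.castLE h) p) = 0 := by
  classical
  refine pderiv_eq_zero_of_notMem_vars fun hv => ?_
  obtain ⟨j, _, hj⟩ := Finset.mem_image.1 (vars_rename _ _ hv)
  rcases hi with rfl | rfl
  · exact castLE_ne.1 hj.symm
  · exact castLE_ne.2 hj.symm

/-- The Jacobian criterion at points of the threefold where the conic fibration is singular. -/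
theorem exists_gradient_ne_zero (hX : IsSmoothHypersurface (threefoldEq l₁ l₂ l₃ g))
    {a : Fin 3 → ℂ} {u v : ℂ} (h0 : a ≠ 0 ∨ u ≠ 0 ∨ v ≠ 0) (hg : eval a g = 0)
    (h1 : eval a l₁ * u + eval a l₃ * v = 0) (h2 : eval a l₃ * u + eval a l₂ * v = 0) :
    ∃ i, eval a (pderiv i l₁) * u ^ 2 + eval a (pderiv i l₂) * v ^ 2 +
      2 * eval a (pderiv i l₃) * u * v + eval a (pderiv i g) ≠ 0 := by
  have h5 : 3 ≤ 5 := by norm_num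
  have h20 : ∀ i : Fin 5, pderiv i (2 : MvPolynomial (Fin 5) ℂ) = 0 := fun i => by
    rw [show (2 : MvPolynomial (Fin 5) ℂ) = C 2 from (map_ofNat C 2).symm, pderiv_C]
  obtain ⟨i, hi⟩ := hX (joinVec a u v) (joinVec_ne_zero h0) (by
    rw [eval_joinVec_threefoldEq]
    linear_combination u * h1 + v * h2 + hg)
  rcases castLE_range h5 i with ⟨j, rfl⟩ | hi'
  · refine ⟨j, fun e => hi ?_⟩
    rw [← e]
    have hinj := Fin.castLE_injective h5
    simp [threefoldEq, pderiv_rename hinj, eval_rename, joinVec_comp_castLE, pderiv_X,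
      castLE_ne.1, castLE_ne.2, h20]
    ring
  -- The derivatives along x₃ and x₄ are twice the left-hand sides of `h1` and `h2`, so they cannot
  -- be the non-zero ones.
  · exfalso
    apply hi
    rcases hi' with rfl | rfl
    · simp [threefoldEq, pderiv_rename_castLE_eq_zero, eval_rename, joinVec_comp_castLE, pderiv_X,
        h20]
      linear_combination 2 * h1
    · simp [threefoldEq, pderiv_rename_castLE_eq_zero, eval_rename, joinVec_comp_castLE, pderiv_X,
        h20]
      linear_combination 2 * h2

/-- At (a, 0, 0) the gradient of the threefold equation is that of g. -/
theorem isSmoothHypersurface_cubic (hX : IsSmoothHypersurface (threefoldEq l₁ l₂ l₃ g)) :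
    IsSmoothHypersurface g := by
  intro a ha hg
  simpa using exists_gradient_ne_zero hX (Or.inl ha) hg (u := 0) (v := 0) (by simp) (by simp)

theorem eval_linear (hl : l₁.IsHomogeneous 1) (a b : Fin 3 → ℂ) :
    a 0 * eval b (pderiv 0 l₁) + a 1 * eval b (pderiv 1 l₁) + a 2 * eval b (pderiv 2 l₁) =
      eval a l₁ := by
  rw [hl.eval_pderiv_const 0 b a, hl.eval_pderiv_const 1 b a, hl.eval_pderiv_const 2 b a,
    hl.eval_euler]
  simp

/-- Two vectors orthogonal to `a` are parallel as soon as one suitable minor vanishes. -/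
theorem minors_eq_of_orthogonal {a v G : Fin 3 → ℂ} (hv : a 0 * v 0 + a 1 * v 1 + a 2 * v 2 = 0)
    (hG : a 0 * G 0 + a 1 * G 1 + a 2 * G 2 = 0) (h : ∃ i, a i ≠ 0 ∧
      v (i + 1) * G (i + 2) = v (i + 2) * G (i + 1)) (i j : Fin 3) : v i * G j = v j * G i := by
  -- The cross product of v and G is parallel to a, so it is zero once its k-th component vanishes
  -- for some k with aₖ ≠ 0.
  obtain ⟨k, hk, h⟩ := h
  apply mul_left_cancel₀ hk
  fin_cases k <;> fin_cases i <;> fin_cases j <;> simp at h ⊢ <;> grind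

/-- The forms `l₁, l₂, l₃` have no common zero on the cubic curve. -/
theorem conic_ne_zero_on_cubic (hl₁ : l₁.IsHomogeneous 1) (hl₂ : l₂.IsHomogeneous 1)
    (hl₃ : l₃.IsHomogeneous 1) (hg : g.IsHomogeneous 3)
    (hX : IsSmoothHypersurface (threefoldEq l₁ l₂ l₃ g)) {a : Fin 3 → ℂ} (ha : a ≠ 0)
    (hga : eval a g = 0) (h1 : eval a l₁ = 0) (h2 : eval a l₂ = 0) (h3 : eval a l₃ = 0) :
    False := by
  obtain ⟨k, hk⟩ := Function.ne_iff.1 ha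
  simp only [Pi.zero_apply] at hk
  let L₁ : Fin 3 → ℂ := fun i => eval a (pderiv i l₁)
  let L₂ : Fin 3 → ℂ := fun i => eval a (pderiv i l₂)
  let L₃ : Fin 3 → ℂ := fun i => eval a (pderiv i l₃)
  let G : Fin 3 → ℂ := fun i => eval a (pderiv i g)
  -- Choose (u, v) so that u²∇l₁ + v²∇l₂ + 2uv∇l₃ is parallel to ∇g(a). By Euler both vectors are
  -- orthogonal to a, so this is a single binary quadratic condition.
  obtain ⟨u, v, huv, hz⟩ := exists_binary_quadratic_zero
    (L₁ (k + 1) * G (k + 2) - L₁ (k + 2) * G (k + 1))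
    (2 * (L₃ (k + 1) * G (k + 2) - L₃ (k + 2) * G (k + 1)))
    (L₂ (k + 1) * G (k + 2) - L₂ (k + 2) * G (k + 1))
  have hG0 : G ≠ 0 := by
    obtain ⟨i, hi⟩ := isSmoothHypersurface_cubic hX a ha hga
    exact fun e => hi (congrFun e i)
  have hGa : a 0 * G 0 + a 1 * G 1 + a 2 * G 2 = 0 := by
    rw [hg.eval_euler, hga, mul_zero]
  obtain ⟨c, hc⟩ := exists_eq_mul_of_minors (v := fun i =>
    L₁ i * u ^ 2 + L₂ i * v ^ 2 + 2 * L₃ i * u * v) hG0 (minors_eq_of_orthogonal (a := a)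
      (by
        have e1 := eval_linear hl₁ a a
        have e2 := eval_linear hl₂ a a
        have e3 := eval_linear hl₃ a a
        rw [h1] at e1
        rw [h2] at e2
        rw [h3] at e3
        linear_combination u ^ 2 * e1 + v ^ 2 * e2 + 2 * u * v * e3) hGa
      ⟨k, hk, by linear_combination hz⟩)
  -- As ∇g has degree 2, the gradient at (t a, u, v) is (c + t²)∇g(a), which vanishes for t² = -c.
  -- The value t = 0 is allowed because (u, v) ≠ 0.
  obtain ⟨t, ht⟩ := IsAlgClosed.exists_eq_mul_self (-c)
  obtain ⟨i, hi⟩ := exists_gradient_ne_zero hX (a := t • a) (u := u) (v := v) (Or.inr huv)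
    (by rw [hg.eval_smul_point, hga, mul_zero])
    (by rw [hl₁.eval_smul_point, hl₃.eval_smul_point, h1, h3]; ring)
    (by rw [hl₂.eval_smul_point, hl₃.eval_smul_point, h2, h3]; ring)
  apply hi
  have hgi : (pderiv i g).IsHomogeneous 2 := hg.pderiv
  rw [hl₁.eval_pderiv_const i _ a, hl₂.eval_pderiv_const i _ a, hl₃.eval_pderiv_const i _ a,
    hgi.eval_smul_point]
  have := hc i
  simp only [L₁, L₂, L₃, G] at this
  linear_combination this - eval a (pderiv i g) * ht

/-- The cubic curve and the conic meet transversally. -/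
theorem exists_minor_ne_zero (hl₁ : l₁.IsHomogeneous 1) (hl₂ : l₂.IsHomogeneous 1)
    (hl₃ : l₃.IsHomogeneous 1) (hg : g.IsHomogeneous 3)
    (hX : IsSmoothHypersurface (threefoldEq l₁ l₂ l₃ g)) {a : Fin 3 → ℂ} (ha : a ≠ 0)
    (hga : eval a g = 0) (hs : eval a (l₁ * l₂ - l₃ ^ 2) = 0) :
    ∃ i j, eval a (pderiv i (l₁ * l₂ - l₃ ^ 2)) * eval a (pderiv j g) ≠
      eval a (pderiv j (l₁ * l₂ - l₃ ^ 2)) * eval a (pderiv i g) := by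
  have hs' : eval a l₁ * eval a l₂ = eval a l₃ ^ 2 := by
    simp only [map_sub, map_mul, map_pow] at hs
    linear_combination hs
  -- A non-zero symmetric 2 × 2 matrix of determinant zero is c times the square of a linear form;
  -- (u, v) spans its kernel.
  obtain ⟨u, v, c, hc, e1, e2, e3⟩ : ∃ u v c : ℂ, c ≠ 0 ∧ eval a l₁ = c * v ^ 2 ∧
      eval a l₂ = c * u ^ 2 ∧ eval a l₃ = -(c * u * v) := by
    by_cases h1 : eval a l₁ = 0
    · have h3 : eval a l₃ = 0 := by
        rw [h1, zero_mul] at hs'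
        exact pow_eq_zero_iff two_ne_zero |>.1 hs'.symm
      exact ⟨1, 0, eval a l₂,
        fun h2 => conic_ne_zero_on_cubic hl₁ hl₂ hl₃ hg hX ha hga h1 h2 h3,
        by simp [h1], by simp, by simp [h3]⟩
    · refine ⟨-eval a l₃ / eval a l₁, 1, eval a l₁, h1, by simp, ?_, ?_⟩
      · field_simp
        linear_combination hs'
      · field_simp
  have hv : u ≠ 0 ∨ v ≠ 0 := by
    by_contra! h
    exact conic_ne_zero_on_cubic hl₁ hl₂ hl₃ hg hX ha hga (by simp [e1, h.2]) (by simp [e2, h.1])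
      (by simp [e3, h.1])
  by_contra! hmin
  have hG0 : (fun i => eval a (pderiv i g)) ≠ 0 := by
    obtain ⟨i, hi⟩ := isSmoothHypersurface_cubic hX a ha hga
    exact fun e => hi (congrFun e i)
  obtain ⟨b, hb⟩ := exists_eq_mul_of_minors hG0 hmin
  -- Here ∇s = c(u²∇l₁ + v²∇l₂ + 2uv∇l₃). If this equals b∇g(a), then the gradient at (t a, u, v) is
  -- (b/c + t²)∇g(a) = 0.
  obtain ⟨t, ht⟩ := IsAlgClosed.exists_eq_mul_self (-b / c)
  obtain ⟨i, hi⟩ := exists_gradient_ne_zero hX (a := t • a) (u := u) (v := v) (Or.inr hv)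
    (by rw [hg.eval_smul_point, hga, mul_zero])
    (by rw [hl₁.eval_smul_point, hl₃.eval_smul_point, e1, e3]; ring)
    (by rw [hl₂.eval_smul_point, hl₃.eval_smul_point, e2, e3]; ring)
  apply hi
  have hgi : (pderiv i g).IsHomogeneous 2 := hg.pderiv
  rw [hl₁.eval_pderiv_const i _ a, hl₂.eval_pderiv_const i _ a, hl₃.eval_pderiv_const i _ a,
    hgi.eval_smul_point, sq t, ← ht]
  have := hb i
  simp only [map_sub, Derivation.leibniz, Derivation.leibniz_pow, smul_eq_mul, map_add, map_mul,
    nsmul_eq_mul, e1, e2, e3, map_pow, map_ofNat, Nat.cast_ofNat] at this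
  field_simp
  linear_combination this

open Filter in
/-- Every point of the cone over the cubic curve is a limit of points not lying over the conic. -/
theorem mem_closure_cone_diff (hl₁ : l₁.IsHomogeneous 1) (hl₂ : l₂.IsHomogeneous 1)
    (hl₃ : l₃.IsHomogeneous 1) (hg : g.IsHomogeneous 3)
    (hX : IsSmoothHypersurface (threefoldEq l₁ l₂ l₃ g)) {a : Fin 3 → ℂ} (ha : a ≠ 0)
    (hga : eval a g = 0) :
    a ∈ closure {x | eval x g = 0 ∧ eval x (l₁ * l₂ - l₃ ^ 2) ≠ 0} := by
  by_cases hs : eval a (l₁ * l₂ - l₃ ^ 2) ≠ 0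
  · exact subset_closure ⟨hga, hs⟩
  rw [not_not] at hs
  obtain ⟨i, j, hij⟩ := exists_minor_ne_zero hl₁ hl₂ hl₃ hg hX ha hga hs
  obtain ⟨f, hf, hfe⟩ := exists_hasStrictFDerivAt_eval g a
  obtain ⟨f', hf', hfe'⟩ := exists_hasStrictFDerivAt_eval (l₁ * l₂ - l₃ ^ 2) a
  -- The map (g, s) to ℂ² is a submersion at a. The preimages are found by Cramer's rule from the
  -- non-zero minor with columns i and j.
  have hsurj : (f.prod f').range = ⊤ := by
    rw [LinearMap.range_eq_top]
    rintro ⟨p, q⟩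
    have key : ∀ (h : Fin 3 → ℂ) (x y : ℂ),
        ∑ m, h m * ((x • Pi.single i (1 : ℂ) + y • Pi.single j (1 : ℂ) : Fin 3 → ℂ) m) =
          h i * x + h j * y := by
      intro h x y
      simp [mul_add, Finset.sum_add_distrib, Pi.single_apply]
    set d := eval a (pderiv i (l₁ * l₂ - l₃ ^ 2)) * eval a (pderiv j g) -
      eval a (pderiv j (l₁ * l₂ - l₃ ^ 2)) * eval a (pderiv i g) with hd
    have hd0 : d ≠ 0 := sub_ne_zero.2 hij
    refine ⟨((q * eval a (pderiv j g) - p * eval a (pderiv j (l₁ * l₂ - l₃ ^ 2))) / d) •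
      Pi.single i (1 : ℂ) + ((p * eval a (pderiv i (l₁ * l₂ - l₃ ^ 2)) -
        q * eval a (pderiv i g)) / d) • Pi.single j (1 : ℂ), ?_⟩
    refine Prod.ext ?_ ?_
    · change f _ = p
      rw [hfe, key]
      field_simp
      rw [hd]
      ring
    · change f' _ = q
      rw [hfe', key]
      field_simp
      rw [hd]
      ring
  have hmap := (hf.prodMk hf').map_nhds_eq_of_surj hsurj
  simp only [hga, hs] at hmap
  rw [mem_closure_iff_nhds]
  intro U hU
  -- A submersion is open at a, so the image of every neighbourhood contains points (0, ε) with ε ≠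
  -- 0.
  have hU' : (fun x => (eval x g, eval x (l₁ * l₂ - l₃ ^ 2))) '' U ∈ 𝓝 ((0 : ℂ), (0 : ℂ)) := by
    rw [← hmap]
    exact image_mem_map hU
  have ht : Tendsto (fun ε : ℂ => ((0 : ℂ), ε)) (𝓝[≠] 0) (𝓝 (0, 0)) :=
    ((by fun_prop : Continuous fun ε : ℂ => ((0 : ℂ), ε)).tendsto' 0 _ rfl).mono_left
      nhdsWithin_le_nhds
  obtain ⟨ε, ⟨x, hxU, hx⟩, hε⟩ := ((ht.eventually_mem hU').and self_mem_nhdsWithin).exists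
  rw [Prod.mk.injEq] at hx
  exact ⟨x, hxU, hx.1, hx.2 ▸ hε⟩

theorem mem_hypersurface_iff {n m : ℕ} {p : MvPolynomial (Fin n) ℂ} (hp : p.IsHomogeneous m)
    {z : ℙ ℂ (Fin n → ℂ)} {x : Fin n → ℂ} (hx : x ∈ (HomCoords.projSpace n).cone z) :
    z ∈ hypersurface p ↔ eval x p = 0 := by
  refine ⟨fun h => h x hx.2, fun h y hy => ?_⟩
  have hxs := hx.2
  rw [Projectivization.submodule_eq, Submodule.mem_span_singleton] at hxs hy
  obtain ⟨c, rfl⟩ := hxs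
  obtain ⟨d, rfl⟩ := hy
  have hc : c ≠ 0 := by
    rintro rfl
    exact hx.1 (zero_smul _ _)
  rw [hp.eval_smul_point] at h ⊢
  rw [(mul_eq_zero.1 h).resolve_left (pow_ne_zero _ hc), mul_zero]

theorem cone_mk {n : ℕ} {x : Fin n → ℂ} (hx : x ≠ 0) :
    x ∈ (HomCoords.projSpace n).cone (Projectivization.mk ℂ x hx) :=
  ⟨hx, by rw [Projectivization.submodule_mk]; exact Submodule.mem_span_singleton_self _⟩

/-- A polynomial vanishing on an open part of the cubic curve away from the conic vanishes on the
whole open part. -/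
theorem eval_eq_zero_of_diff_conic (hl₁ : l₁.IsHomogeneous 1) (hl₂ : l₂.IsHomogeneous 1)
    (hl₃ : l₃.IsHomogeneous 1) (hg : g.IsHomogeneous 3)
    (hX : IsSmoothHypersurface (threefoldEq l₁ l₂ l₃ g)) {V : Set (hypersurface g)}
    (hV : IsOpen[(cubicCoords g).zariski] V) (P : MvPolynomial (Fin 3) ℂ)
    (hP : ∀ p ∈ V, ∀ x ∈ (cubicCoords g).cone p, eval x (l₁ * l₂ - l₃ ^ 2) ≠ 0 → eval x P = 0)
    {p : hypersurface g} (hp : p ∈ V) {x : Fin 3 → ℂ} (hx : x ∈ (cubicCoords g).cone p) :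
    eval x P = 0 := by
  obtain ⟨k, B, hB, hB0, hBV⟩ := (cubicCoords g).exists_nonvanishing_subset hV hp
  have hxg : eval x g = 0 := p.2 x hx.2
  have hcl := mem_closure_cone_diff hl₁ hl₂ hl₃ hg hX hx.1 hxg
  by_contra hne
  -- Euclidean density is used here: if P(x) ≠ 0, then some y near x on the cone, off the conic,
  -- still has P(y)B(y) ≠ 0. The factor B keeps [y] inside V.
  have hopen : IsOpen {y : Fin 3 → ℂ | eval y (P * B) ≠ 0} :=
    isOpen_ne_fun (continuous_eval _) continuous_const
  obtain ⟨y, hy, hyg, hys⟩ := mem_closure_iff.1 hcl _ hopen (by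
    change eval x (P * B) ≠ 0
    rw [map_mul]
    exact mul_ne_zero hne (hB0 x hx))
  have hy0 : y ≠ 0 := by
    rintro rfl
    apply hys
    have h1 := hl₁.eval_smul_point 0 0
    have h3 := hl₃.eval_smul_point 0 0
    simp only [smul_zero, pow_one, zero_mul] at h1 h3
    rw [map_sub, map_mul, map_pow, h1, h3]
    ring
  have hyB : eval y P * eval y B ≠ 0 := by simpa using hy
  refine left_ne_zero_of_mul hyB (hP
    ⟨Projectivization.mk ℂ y hy0, (mem_hypersurface_iff hg (cone_mk hy0)).2 hyg⟩
    (hBV _ fun z hz => ?_) y (cone_mk hy0) hys)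
  exact ((HomCoords.projSpace_wellFormed 3).restrict _).eval_ne_zero (cone_mk hy0) hz hB
    (right_ne_zero_of_mul hyB)

end Threefold

/-! ### Points of the double cover -/

section CoverPoints

variable {l₁ l₂ l₃ g : MvPolynomial (Fin 3) ℂ}

/-- The data of a smooth cubic threefold with an involution of non-Eckardt type. -/
structure IsSmoothNormalForm (l₁ l₂ l₃ g : MvPolynomial (Fin 3) ℂ) : Prop where
  hl₁ : l₁.IsHomogeneous 1
  hl₂ : l₂.IsHomogeneous 1
  hl₃ : l₃.IsHomogeneous 1
  hg : g.IsHomogeneous 3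
  smooth : IsSmoothHypersurface (threefoldEq l₁ l₂ l₃ g)

theorem mem_submodule_iff_of_cone {n : ℕ} {p : ℙ ℂ (Fin n → ℂ)} {a : Fin n → ℂ}
    (ha : a ∈ (HomCoords.projSpace n).cone p) {x : Fin n → ℂ} :
    x ∈ p.submodule ↔ ∃ c : ℂ, x = c • a := by
  obtain ⟨ha0, hap⟩ := ha
  have h : p = Projectivization.mk ℂ a ha0 := by
    rw [Projectivization.submodule_eq, Submodule.mem_span_singleton] at hap
    obtain ⟨c, hc⟩ := hap
    refine p.mk_rep.symm.trans ((Projectivization.mk_eq_mk_iff' ℂ _ _ _ _).2 ⟨c⁻¹, ?_⟩)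
    rw [← hc, smul_smul, inv_mul_cancel₀, one_smul]
    rintro rfl
    exact ha0 (by rw [← hc, zero_smul])
  rw [h, Projectivization.submodule_mk, Submodule.mem_span_singleton]
  exact ⟨fun ⟨c, hc⟩ => ⟨c, hc.symm⟩, fun ⟨c, hc⟩ => ⟨c, hc.symm⟩⟩

theorem eq_of_mem_cone {n : ℕ} {p q : ℙ ℂ (Fin n → ℂ)} {a : Fin n → ℂ}
    (hp : a ∈ (HomCoords.projSpace n).cone p) (hq : a ∈ (HomCoords.projSpace n).cone q) :
    p = q := by
  apply Projectivization.submodule_injective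
  ext x
  rw [mem_submodule_iff_of_cone hp, mem_submodule_iff_of_cone hq]

theorem smul_mem_cone {n : ℕ} {p : ℙ ℂ (Fin n → ℂ)} {a : Fin n → ℂ}
    (hp : a ∈ (HomCoords.projSpace n).cone p) {c : ℂ} (hc : c ≠ 0) :
    c • a ∈ (HomCoords.projSpace n).cone p :=
  ⟨smul_ne_zero hc hp.1, Submodule.smul_mem _ _ hp.2⟩

theorem MvPolynomial.IsHomogeneous.rename_inr_bidegree {σ τ : Type} {p : MvPolynomial τ ℂ} {n : ℕ}
    (hp : p.IsHomogeneous n) {w : σ → ℤ × ℤ} :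
    IsWeightedHomogeneous (Sum.elim w fun _ => ((0 : ℤ), (1 : ℤ))) (rename Sum.inr p)
      (0, (n : ℤ)) := by
  have := hp.rename_isWeightedHomogeneous (Sum.inr : τ → σ ⊕ τ)
    (w := Sum.elim w fun _ => ((0 : ℤ), (1 : ℤ))) (m := (0, 1)) fun _ => rfl
  simpa using this

/-- Points of the blow-up over `[a]` satisfy the equation of the conic. -/
theorem conic_of_mem_blowUpL (h : IsSmoothNormalForm l₁ l₂ l₃ g) {x : ℙ ℂ (Fin 5 → ℂ)}
    {p : ℙ ℂ (Fin 3 → ℂ)} (hxp : (x, p) ∈ blowUpL (hypersurface (threefoldEq l₁ l₂ l₃ g)))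
    {a : Fin 3 → ℂ} (ha : a ∈ (HomCoords.projSpace 3).cone p) (hga : eval a g = 0)
    {w : Fin 5 → ℂ} (hw : w ∈ (HomCoords.projSpace 5).cone x) :
    (∃ t : ℂ, projL w = t • a) ∧
      eval a l₁ * w 3 ^ 2 + eval a l₂ * w 4 ^ 2 + 2 * eval a l₃ * w 3 * w 4 = 0 := by
  set H := (HomCoords.projSpace 5).prod (HomCoords.projSpace 3) with hH
  have hwf : H.WellFormed :=
    (HomCoords.projSpace_wellFormed 5).prod (HomCoords.projSpace_wellFormed 3)
  have h5 : 3 ≤ 5 := by norm_num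
  have hL : ∀ j, IsWeightedHomogeneous H.wt (X (Sum.inl j)) ((1 : ℤ), (0 : ℤ)) := fun j =>
    isWeightedHomogeneous_X ℂ H.wt (Sum.inl j)
  have hR : ∀ j, IsWeightedHomogeneous H.wt (X (Sum.inr j)) ((0 : ℤ), (1 : ℤ)) := fun j =>
    isWeightedHomogeneous_X ℂ H.wt (Sum.inr j)
  have hwt : H.wt = Sum.elim (fun _ => ((1 : ℤ), (0 : ℤ))) (fun _ => ((0 : ℤ), (1 : ℤ))) := rfl
  have hl : ∀ {l : MvPolynomial (Fin 3) ℂ}, l.IsHomogeneous 1 →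
      IsWeightedHomogeneous H.wt (rename Sum.inr l) ((0 : ℤ), (1 : ℤ)) := fun hl => by
    rw [hwt]; exact hl.rename_inr_bidegree
  have hg' : IsWeightedHomogeneous H.wt (rename Sum.inr g) ((0 : ℤ), (3 : ℤ)) := by
    rw [hwt]; exact h.hg.rename_inr_bidegree
  let E : Fin 3 → Fin 3 → MvPolynomial (Fin 5 ⊕ Fin 3) ℂ := fun i j =>
    X (Sum.inl (Fin.castLE h5 i)) * X (Sum.inr j) - X (Sum.inl (Fin.castLE h5 j)) * X (Sum.inr i)
  have hE : ∀ i j, IsWeightedHomogeneous H.wt (E i j) ((1 : ℤ), (1 : ℤ)) := fun i j =>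
    ((hL _).mul (hR _)).sub ((hL _).mul (hR _))
  -- Where (x₀, x₁, x₂) = t a with t ≠ 0, the cubic equation is t(q_a + t²g(a)) = 0. Dividing by t
  -- and multiplying by aᵢ² gives the bihomogeneous equation aᵢ²q_a + xᵢ²g(a) = 0, which persists on
  -- the closure.
  let K : Fin 3 → MvPolynomial (Fin 5 ⊕ Fin 3) ℂ := fun i =>
    X (Sum.inr i) ^ 2 * (rename Sum.inr l₁ * X (Sum.inl 3) ^ 2 +
      rename Sum.inr l₂ * X (Sum.inl 4) ^ 2 +
      C 2 * (rename Sum.inr l₃ * (X (Sum.inl 3) * X (Sum.inl 4)))) +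
    X (Sum.inl (Fin.castLE h5 i)) ^ 2 * rename Sum.inr g
  have hK : ∀ i, IsWeightedHomogeneous H.wt (K i) ((2 : ℤ), (3 : ℤ)) := fun i =>
    (((hR i).pow 2).mul ((((hl h.hl₁).mul ((hL 3).pow 2)).add
      ((hl h.hl₂).mul ((hL 4).pow 2))).add (((hl h.hl₃).mul ((hL 3).mul (hL 4))).C_mul 2))).add
      (((hL _).pow 2).mul hg')
  have hEe : ∀ i j z, eval z (E i j) = z (Sum.inl (Fin.castLE h5 i)) * z (Sum.inr j) -
      z (Sum.inl (Fin.castLE h5 j)) * z (Sum.inr i) := fun i j z => by simp [E]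
  have hKe : ∀ i z, eval z (K i) = z (Sum.inr i) ^ 2 *
      (eval (z ∘ Sum.inr) l₁ * z (Sum.inl 3) ^ 2 + eval (z ∘ Sum.inr) l₂ * z (Sum.inl 4) ^ 2 +
        2 * (eval (z ∘ Sum.inr) l₃ * (z (Sum.inl 3) * z (Sum.inl 4)))) +
      z (Sum.inl (Fin.castLE h5 i)) ^ 2 * eval (z ∘ Sum.inr) g := fun i z => by
    simp [K, eval_rename]
  let S : Set (ℙ ℂ (Fin 5 → ℂ) × ℙ ℂ (Fin 3 → ℂ)) :=
    (⋂ i, ⋂ j, {z | ∀ x ∈ H.cone z, eval x (E i j) = 0}) ∩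
      ⋂ i, {z | ∀ x ∈ H.cone z, eval x (K i) = 0}
  have hclosed : @IsClosed _ H.zariski S := by
    let _ := H.zariski
    exact (isClosed_iInter fun i => isClosed_iInter fun j =>
      hwf.isClosed_vanishing (hE i j)).inter
        (isClosed_iInter fun i => hwf.isClosed_vanishing (hK i))
  have hmem : (x, p) ∈ S := by
    let _ := H.zariski
    refine closure_minimal ?_ hclosed hxp
    rintro ⟨q, r⟩ ⟨hq, ⟨x', hx', hx'0⟩, hqr⟩
    have key : ∀ z ∈ H.cone (q, r), ∃ t : ℂ, t ≠ 0 ∧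
        (∀ i, z (Sum.inl (Fin.castLE h5 i)) = t * z (Sum.inr i)) ∧
        eval (fun i => z (Sum.inl i)) (threefoldEq l₁ l₂ l₃ g) = 0 := by
      rintro z ⟨hz1, hz2⟩
      obtain ⟨t, ht⟩ := (mem_submodule_iff_of_cone hz2).1 (hqr _ hz1.2)
      refine ⟨t, ?_, fun i => congrFun ht i, hq _ hz1.2⟩
      rintro rfl
      apply hx'0
      obtain ⟨c, rfl⟩ := (mem_submodule_iff_of_cone hz1).1 hx'
      rw [zero_smul] at ht
      funext i
      have := congrFun ht i
      simp only [projL, Pi.zero_apply] at this ⊢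
      simp [this]
    refine ⟨Set.mem_iInter.2 fun i => Set.mem_iInter.2 fun j z hz => ?_,
      Set.mem_iInter.2 fun i z hz => ?_⟩
    · obtain ⟨t, -, ht, -⟩ := key z hz
      rw [hEe, ht, ht]
      ring
    · obtain ⟨t, ht0, ht, hF⟩ := key z hz
      have hz : projL (fun i => z (Sum.inl i)) = t • (z ∘ Sum.inr) := funext ht
      rw [← joinVec_projL (fun i => z (Sum.inl i)), eval_joinVec_threefoldEq, hz,
        h.hl₁.eval_smul_point, h.hl₂.eval_smul_point, h.hl₃.eval_smul_point,
        h.hg.eval_smul_point] at hF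
      rw [hKe, ht]
      apply mul_left_cancel₀ ht0
      linear_combination z (Sum.inr i) ^ 2 * hF
  have hz : Sum.elim w a ∈ H.cone (x, p) := ⟨hw, ha⟩
  obtain ⟨i, hi⟩ := Function.ne_iff.1 ha.1
  simp only [Pi.zero_apply] at hi
  constructor
  · refine ⟨w (Fin.castLE h5 i) / a i, funext fun j => ?_⟩
    have := Set.mem_iInter.1 (Set.mem_iInter.1 hmem.1 i) j _ hz
    rw [hEe] at this
    simp only [Sum.elim_inl, Sum.elim_inr] at this
    simp only [projL, Pi.smul_apply, smul_eq_mul]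
    field_simp
    linear_combination -this
  · have := Set.mem_iInter.1 hmem.2 i _ hz
    rw [hKe, show Sum.elim w a ∘ Sum.inr = a from rfl, hga] at this
    simp only [Sum.elim_inl, Sum.elim_inr] at this
    apply mul_left_cancel₀ (pow_ne_zero 2 hi)
    linear_combination this

/-- Over the cubic curve, the points of the conic lie in the strict transform. -/
theorem mem_blowUpL_of_conic (h : IsSmoothNormalForm l₁ l₂ l₃ g) {x : ℙ ℂ (Fin 5 → ℂ)}
    {p : ℙ ℂ (Fin 3 → ℂ)} {a : Fin 3 → ℂ} (ha : a ∈ (HomCoords.projSpace 3).cone p)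
    (hga : eval a g = 0) {t u v : ℂ} (hx : joinVec (t • a) u v ∈ (HomCoords.projSpace 5).cone x)
    (hq : eval a l₁ * u ^ 2 + eval a l₂ * v ^ 2 + 2 * eval a l₃ * u * v = 0) :
    (x, p) ∈ blowUpL (hypersurface (threefoldEq l₁ l₂ l₃ g)) := by
  set H := (HomCoords.projSpace 5).prod (HomCoords.projSpace 3) with hH
  have hwf : H.WellFormed :=
    (HomCoords.projSpace_wellFormed 5).prod (HomCoords.projSpace_wellFormed 3)
  let _ := H.zariski
  change (x, p) ∈ closure _
  rw [H.isTopologicalBasis_nonvanishing.mem_closure_iff]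
  rintro _ ⟨k, B, hB, rfl⟩ hB0
  -- The given point lies on L when t = 0. It is then approached along the points (s a, u, v) with s
  -- ≠ 0, which lie on X \ L because g(a) = 0 and q_a(u, v) = 0.
  have hcont : Continuous fun s : ℂ => eval (Sum.elim (joinVec (s • a) u v) a) B := by
    refine (continuous_eval B).comp (continuous_pi fun i => ?_)
    rcases i with i | i
    · simp only [Sum.elim_inl]
      fin_cases i <;> simp [joinVec] <;> fun_prop
    · exact continuous_const
  obtain ⟨s, hs, hs0⟩ := (dense_compl_singleton (0 : ℂ)).inter_open_nonempty
    {s | eval (Sum.elim (joinVec (s • a) u v) a) B ≠ 0}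
    (isOpen_ne_fun hcont continuous_const) ⟨t, hB0 _ ⟨hx, ha⟩⟩
  have hs0 : s ≠ 0 := hs0
  have hne : joinVec (s • a) u v ≠ 0 := joinVec_ne_zero (Or.inl (smul_ne_zero hs0 ha.1))
  refine ⟨(Projectivization.mk ℂ _ hne, p), ?_, ?_, ?_, ?_⟩
  · intro z hz
    exact hwf.eval_ne_zero (x := Sum.elim (joinVec (s • a) u v) a) ⟨cone_mk hne, ha⟩ hz hB hs
  · have hF : (threefoldEq l₁ l₂ l₃ g).IsHomogeneous 3 := by
      have hL : ∀ {l : MvPolynomial (Fin 3) ℂ}, l.IsHomogeneous 1 →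
        (rename (Fin.castLE (by norm_num : 3 ≤ 5)) l).IsHomogeneous 1 :=
          fun h => h.rename_isHomogeneous
      have hX : ∀ i : Fin 5, (X i : MvPolynomial (Fin 5) ℂ).IsHomogeneous 1 := isHomogeneous_X ℂ
      have h2 : (2 : MvPolynomial (Fin 5) ℂ).IsHomogeneous 0 := by
        rw [show (2 : MvPolynomial (Fin 5) ℂ) = C 2 from (map_ofNat C 2).symm]
        exact isHomogeneous_C _ _
      exact ((((hL h.hl₁).mul ((hX 3).pow 2)).add ((hL h.hl₂).mul ((hX 4).pow 2))).add
        (((h2.mul (hL h.hl₃)).mul (hX 3)).mul (hX 4))).add h.hg.rename_isHomogeneous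
    refine (mem_hypersurface_iff hF (cone_mk hne)).2 ?_
    rw [eval_joinVec_threefoldEq, h.hl₁.eval_smul_point, h.hl₂.eval_smul_point,
      h.hl₃.eval_smul_point, h.hg.eval_smul_point, hga]
    linear_combination s * hq
  · exact ⟨_, (cone_mk hne).2, by rw [projL_joinVec]; exact smul_ne_zero hs0 ha.1⟩
  · intro y hy
    obtain ⟨c, rfl⟩ := (mem_submodule_iff_of_cone (cone_mk hne)).1 hy
    have : projL (c • joinVec (s • a) u v) = c • projL (joinVec (s • a) u v) := rfl
    rw [this, projL_joinVec]
    exact Submodule.smul_mem _ _ (Submodule.smul_mem _ _ ha.2)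

end CoverPoints

/-! ### Points of the cover as square roots of l₁l₂ - l₃² -/

section Representatives

variable {l₁ l₂ l₃ g : MvPolynomial (Fin 3) ℂ}

/-- The point `z` of the double cover is `([a], m)`, where the line `m` is spanned by `(a, 0, 0)`
and `(0, u, v)`, and `y` is the corresponding square root of `l₁ l₂ - l₃²` at `a`. -/
structure IsRep (z : coverOfCubic l₁ l₂ l₃ g) (a : Fin 3 → ℂ) (u v y : ℂ) : Prop where
  mem_cone : a ∈ (HomCoords.projSpace 3).cone z.1.1
  ne_zero : u ≠ 0 ∨ v ≠ 0
  span : z.1.2.1 = Submodule.span ℂ {joinVec a 0 0, joinVec 0 u v}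
  eq₁ : eval a l₁ * u + eval a l₃ * v = Complex.I * y * v
  eq₂ : eval a l₃ * u + eval a l₂ * v = -(Complex.I * y * u)

theorem smul_joinVec (c : ℂ) (a : Fin 3 → ℂ) (u v : ℂ) :
    c • joinVec a u v = joinVec (c • a) (c * u) (c * v) := by
  funext i
  fin_cases i <;> rfl

theorem joinVec_add (a b : Fin 3 → ℂ) (u v u' v' : ℂ) :
    joinVec a u v + joinVec b u' v' = joinVec (a + b) (u + u') (v + v') := by
  funext i
  fin_cases i <;> rfl

theorem mem_span_joinVec_pair {a : Fin 3 → ℂ} {u v : ℂ} {x : Fin 5 → ℂ} :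
    x ∈ Submodule.span ℂ {joinVec a 0 0, joinVec 0 u v} ↔
      ∃ s t : ℂ, x = joinVec (s • a) (t * u) (t * v) := by
  rw [Submodule.mem_span_pair]
  simp only [smul_joinVec, joinVec_add, mul_zero, smul_zero, add_zero, zero_add]
  exact ⟨fun ⟨s, t, h⟩ => ⟨s, t, h.symm⟩, fun ⟨s, t, h⟩ => ⟨s, t, h.symm⟩⟩

theorem joinVec_injective {a b : Fin 3 → ℂ} {u v u' v' : ℂ}
    (h : joinVec a u v = joinVec b u' v') : a = b ∧ u = u' ∧ v = v' :=
  ⟨by rw [← projL_joinVec a u v, h, projL_joinVec], congrFun h 3, congrFun h 4⟩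

theorem linearIndependent_joinVec_pair {a : Fin 3 → ℂ} {u v : ℂ} (ha : a ≠ 0)
    (huv : u ≠ 0 ∨ v ≠ 0) : LinearIndependent ℂ ![joinVec a 0 0, joinVec 0 u v] := by
  rw [LinearIndependent.pair_iff]
  intro s t h
  rw [smul_joinVec, smul_joinVec, joinVec_add] at h
  have h0 : (0 : Fin 5 → ℂ) = joinVec 0 0 0 := by
    funext i
    fin_cases i <;> rfl
  rw [h0] at h
  obtain ⟨h1, h2, h3⟩ := joinVec_injective h
  simp only [smul_zero, add_zero, mul_zero, zero_add] at h1 h2 h3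
  refine ⟨(smul_eq_zero.1 h1).resolve_right ha, ?_⟩
  rcases huv with hu | hv
  · exact (mul_eq_zero.1 h2).resolve_right hu
  · exact (mul_eq_zero.1 h3).resolve_right hv

theorem finrank_span_joinVec_pair {a : Fin 3 → ℂ} {u v : ℂ} (ha : a ≠ 0)
    (huv : u ≠ 0 ∨ v ≠ 0) :
    Module.finrank ℂ (Submodule.span ℂ {joinVec a 0 0, joinVec 0 u v}) = 2 := by
  have := finrank_span_eq_card (linearIndependent_joinVec_pair ha huv)
  rwa [Matrix.range_cons_cons_empty] at this

namespace IsRep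

variable {z : coverOfCubic l₁ l₂ l₃ g} {a : Fin 3 → ℂ} {u v y : ℂ}

theorem eval_cubic (hr : IsRep z a u v y) : eval a g = 0 := z.2.2 a hr.mem_cone.2

/-- The two equations say that (u, v) ≠ 0 is killed by the matrix with rows (l₁, l₃ - iy) and (l₃ +
iy, l₂), whose determinant is l₁l₂ - l₃² - y². -/
theorem sq_eq (hr : IsRep z a u v y) : y ^ 2 = eval a (l₁ * l₂ - l₃ ^ 2) := by
  simp only [map_sub, map_mul, map_pow]
  have h1 := hr.eq₁
  have h2 := hr.eq₂
  have hI := Complex.I_sq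
  rcases hr.ne_zero with hu | hv
  · apply mul_right_cancel₀ hu
    linear_combination (-eval a l₂) * h1 + (eval a l₃ - Complex.I * y) * h2 + y ^ 2 * u * hI
  · apply mul_right_cancel₀ hv
    linear_combination (eval a l₃ + Complex.I * y) * h1 - eval a l₁ * h2 + y ^ 2 * v * hI

theorem smul_kernel (hr : IsRep z a u v y) {c : ℂ} (hc : c ≠ 0) :
    IsRep z a (c * u) (c * v) y where
  mem_cone := hr.mem_cone
  ne_zero := hr.ne_zero.imp (mul_ne_zero hc) (mul_ne_zero hc)
  span := by
    rw [hr.span]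
    ext x
    simp only [mem_span_joinVec_pair]
    constructor
    · rintro ⟨s, t, rfl⟩
      refine ⟨s, t / c, ?_⟩
      congr 1 <;> field_simp
    · rintro ⟨s, t, rfl⟩
      refine ⟨s, t * c, ?_⟩
      congr 1 <;> ring
  eq₁ := by linear_combination c * hr.eq₁
  eq₂ := by linear_combination c * hr.eq₂

/-- The matrix entries are linear in a, so y has weight one: this is the source of 𝒪(1). -/
theorem smul_point (h : IsSmoothNormalForm l₁ l₂ l₃ g) (hr : IsRep z a u v y) {c : ℂ}
    (hc : c ≠ 0) : IsRep z (c • a) u v (c * y) where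
  mem_cone := smul_mem_cone hr.mem_cone hc
  ne_zero := hr.ne_zero
  span := by
    rw [hr.span]
    ext x
    simp only [mem_span_joinVec_pair]
    constructor
    · rintro ⟨s, t, rfl⟩
      refine ⟨s / c, t, ?_⟩
      rw [smul_smul, div_mul_cancel₀ _ hc]
    · rintro ⟨s, t, rfl⟩
      exact ⟨s * c, t, by rw [smul_smul]⟩
  eq₁ := by
    rw [h.hl₁.eval_smul_point, h.hl₃.eval_smul_point]
    linear_combination c * hr.eq₁
  eq₂ := by
    rw [h.hl₂.eval_smul_point, h.hl₃.eval_smul_point]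
    linear_combination c * hr.eq₂

theorem exists_scalar {a' : Fin 3 → ℂ} {u' v' y' : ℂ} (hr : IsRep z a u v y)
    (hr' : IsRep z a' u' v' y') :
    ∃ t : ℂ, t ≠ 0 ∧ u' = t * u ∧ v' = t * v := by
  have hm : joinVec 0 u' v' ∈ z.1.2.1 := by
    rw [hr'.span]
    exact Submodule.subset_span (by simp)
  rw [hr.span, mem_span_joinVec_pair] at hm
  obtain ⟨s, t, hst⟩ := hm
  obtain ⟨-, h2, h3⟩ := joinVec_injective hst
  refine ⟨t, ?_, h2, h3⟩
  rintro rfl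
  rcases hr'.ne_zero with h0 | h0
  · exact h0 (by rw [h2, zero_mul])
  · exact h0 (by rw [h3, zero_mul])

/-- The square root is determined by the point of the cover and the coordinates of its image. -/
theorem root_unique {u' v' y' : ℂ} (hr : IsRep z a u v y) (hr' : IsRep z a u' v' y') :
    y' = y := by
  obtain ⟨t, ht, rfl, rfl⟩ := hr.exists_scalar hr'
  have h1 := hr.eq₁
  have h2 := hr.eq₂
  have h1' := hr'.eq₁
  have h2' := hr'.eq₂
  have hI := Complex.I_ne_zero
  rcases hr.ne_zero with hu | hv
  · apply mul_left_cancel₀ (mul_ne_zero (mul_ne_zero hI ht) hu)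
    linear_combination h2' - t * h2
  · apply mul_left_cancel₀ (mul_ne_zero (mul_ne_zero hI ht) hv)
    linear_combination t * h1 - h1'

theorem root_smul (h : IsSmoothNormalForm l₁ l₂ l₃ g) {c u' v' y' : ℂ} (hc : c ≠ 0)
    (hr : IsRep z a u v y) (hr' : IsRep z (c • a) u' v' y') : y' = c * y :=
  (hr.smul_point h hc).root_unique hr'

/-- The point of the cover is determined by the image point and the square root. -/
theorem point_unique (h : IsSmoothNormalForm l₁ l₂ l₃ g) {z' : coverOfCubic l₁ l₂ l₃ g}
    {u' v' : ℂ} (hr : IsRep z a u v y) (hr' : IsRep z' a u' v' y) : z' = z := by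
  -- Two independent kernel vectors would make l₁, l₂, l₃ - iy and l₃ + iy all vanish, hence also
  -- l₃, against `conic_ne_zero_on_cubic`.
  have hdet : u * v' = u' * v := by
    by_contra hne
    have hne : u * v' - u' * v ≠ 0 := sub_ne_zero.2 hne
    have e1 : eval a l₁ = 0 := by
      apply mul_left_cancel₀ hne
      linear_combination v' * hr.eq₁ - v * hr'.eq₁
    have e2 : eval a l₂ = 0 := by
      apply mul_left_cancel₀ hne
      linear_combination u * hr'.eq₂ - u' * hr.eq₂
    have e3 : eval a l₃ = 0 := by
      apply mul_left_cancel₀ (mul_ne_zero two_ne_zero hne)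
      linear_combination u * hr'.eq₁ - u' * hr.eq₁ + v' * hr.eq₂ - v * hr'.eq₂
    exact conic_ne_zero_on_cubic h.hl₁ h.hl₂ h.hl₃ h.hg h.smooth hr.mem_cone.1 hr.eval_cubic
      e1 e2 e3
  obtain ⟨t, ht, hu, hv⟩ : ∃ t : ℂ, t ≠ 0 ∧ u' = t * u ∧ v' = t * v := by
    rcases hr.ne_zero with hu | hv
    · have hu' : u' ≠ 0 := by
        rintro rfl
        rw [zero_mul] at hdet
        rcases hr'.ne_zero with h0 | h0
        · exact h0 rfl
        · exact h0 ((mul_eq_zero.1 hdet).resolve_left hu)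
      refine ⟨u' / u, div_ne_zero hu' hu, by field_simp, ?_⟩
      field_simp
      linear_combination hdet
    · have hv' : v' ≠ 0 := by
        rintro rfl
        rw [mul_zero] at hdet
        rcases hr'.ne_zero with h0 | h0
        · exact h0 ((mul_eq_zero.1 hdet.symm).resolve_right hv)
        · exact h0 rfl
      refine ⟨v' / v, div_ne_zero hv' hv, ?_, by field_simp⟩
      field_simp
      linear_combination -hdet
  apply Subtype.ext
  refine Prod.ext (eq_of_mem_cone hr'.mem_cone hr.mem_cone) (Subtype.ext ?_)
  rw [hr'.span, (hr.smul_kernel ht).span, hu, hv]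

/-- The line is recovered from the square root by means of a non-isotropic vector `(b, c)`. -/
theorem recover (hr : IsRep z a u v y) {b c : ℂ}
    (hbc : eval a l₁ * b ^ 2 + eval a l₂ * c ^ 2 + 2 * eval a l₃ * b * c ≠ 0) :
    IsRep z a (eval a l₃ * b + eval a l₂ * c - Complex.I * b * y)
      (-(eval a l₁ * b + eval a l₃ * c + Complex.I * c * y)) y := by
  set q := eval a l₁ * b ^ 2 + eval a l₂ * c ^ 2 + 2 * eval a l₃ * b * c with hq
  set U := eval a l₃ * b + eval a l₂ * c - Complex.I * b * y with hU
  set V := -(eval a l₁ * b + eval a l₃ * c + Complex.I * c * y) with hV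
  -- (U, V) is the adjugate of the matrix with rows (l₁, l₃ - iy), (l₃ + iy, l₂), applied to (c,
  -- -b); it therefore lies on the kernel line. Its factor relative to (u, v) is non-zero exactly
  -- because q ≠ 0.
  have e1 : q * u = (c * u - b * v) * U := by
    rw [hq, hU]
    linear_combination b ^ 2 * hr.eq₁ + b * c * hr.eq₂
  have e2 : q * v = (c * u - b * v) * V := by
    rw [hq, hV]
    linear_combination b * c * hr.eq₁ + c ^ 2 * hr.eq₂
  have hlam : c * u - b * v ≠ 0 := by
    intro e
    rw [e, zero_mul] at e1 e2
    rcases hr.ne_zero with h0 | h0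
    · exact mul_ne_zero hbc h0 e1
    · exact mul_ne_zero hbc h0 e2
  have := hr.smul_kernel (c := q / (c * u - b * v)) (div_ne_zero hbc hlam)
  rwa [show q / (c * u - b * v) * u = U by field_simp; linear_combination e1,
    show q / (c * u - b * v) * v = V by field_simp; linear_combination e2] at this

end IsRep

/-- Polarisation: the values at (1, 0), (0, 1) and (1, 1) recover l₁, l₂, l₃, which do not all
vanish at a. -/
theorem exists_nonisotropic (h : IsSmoothNormalForm l₁ l₂ l₃ g) {a : Fin 3 → ℂ} (ha : a ≠ 0)
    (hga : eval a g = 0) : ∃ b c : ℂ,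
      eval a l₁ * b ^ 2 + eval a l₂ * c ^ 2 + 2 * eval a l₃ * b * c ≠ 0 := by
  by_contra! hq
  have h1 := hq 1 0
  have h2 := hq 0 1
  have h3 := hq 1 1
  refine conic_ne_zero_on_cubic h.hl₁ h.hl₂ h.hl₃ h.hg h.smooth ha hga ?_ ?_ ?_
  · linear_combination h1
  · linear_combination h2
  · linear_combination (h3 - h1 - h2) / 2

theorem discriminantCurve_eq (h : IsSmoothNormalForm l₁ l₂ l₃ g) :
    discriminantCurve l₁ l₂ l₃ g = hypersurface g ∪ hypersurface (l₁ * l₂ - l₃ ^ 2) := by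
  have hQ : (l₁ * l₂ - l₃ ^ 2).IsHomogeneous 2 := (h.hl₁.mul h.hl₂).sub (h.hl₃.pow 2)
  have hdet : (conicMatrix l₁ l₂ l₃ g).det = g * (l₁ * l₂ - l₃ ^ 2) := by
    simp only [conicMatrix, Matrix.det_fin_three, Matrix.of_apply, Matrix.cons_val', Matrix.cons_val]
    ring
  ext p
  obtain ⟨a, ha⟩ := (HomCoords.projSpace_wellFormed 3).nonempty p
  rw [discriminantCurve, hdet, Set.mem_union, mem_hypersurface_iff (h.hg.mul hQ) ha,
    mem_hypersurface_iff h.hg ha, mem_hypersurface_iff hQ ha, map_mul, mul_eq_zero]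

/-- Isotropy makes the image of (u, v) orthogonal to (u, v), hence a multiple of (v, -u). Writing
the multiple as iy turns y² = -s into y² = s. -/
theorem exists_root {a : Fin 3 → ℂ} {u v : ℂ} (huv : u ≠ 0 ∨ v ≠ 0)
    (hq : eval a l₁ * u ^ 2 + eval a l₂ * v ^ 2 + 2 * eval a l₃ * u * v = 0) :
    ∃ y : ℂ, eval a l₁ * u + eval a l₃ * v = Complex.I * y * v ∧
      eval a l₃ * u + eval a l₂ * v = -(Complex.I * y * u) := by
  have hI := Complex.I_sq
  rcases huv with hu | hv
  · refine ⟨Complex.I * (eval a l₃ * u + eval a l₂ * v) / u, ?_, ?_⟩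
    · field_simp
      rw [hI]
      linear_combination hq
    · field_simp
      rw [hI]
      ring
  · refine ⟨-Complex.I * (eval a l₁ * u + eval a l₃ * v) / v, ?_, ?_⟩
    · field_simp
      rw [hI]
      ring
    · field_simp
      rw [hI]
      linear_combination hq

/-- Because q_a ≠ 0, the fibre is a cone with vertex (a, 0, 0), and every line in it passes through
the vertex and a point of L. -/
theorem exists_isRep (h : IsSmoothNormalForm l₁ l₂ l₃ g) (z : coverOfCubic l₁ l₂ l₃ g)
    {a : Fin 3 → ℂ} (ha : a ∈ (HomCoords.projSpace 3).cone z.1.1) :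
    ∃ u v y, IsRep z a u v y := by
  revert ha
  obtain ⟨⟨p, m, hm⟩, ⟨-, hz⟩, hp⟩ := z
  intro ha
  have hga : eval a g = 0 := hp a ha.2
  simp only at ha hz
  have key : ∀ x ∈ m, (∃ t : ℂ, projL x = t • a) ∧
      eval a l₁ * x 3 ^ 2 + eval a l₂ * x 4 ^ 2 + 2 * eval a l₃ * x 3 * x 4 = 0 := by
    intro x hx
    by_cases hx0 : x = 0
    · subst hx0
      exact ⟨⟨0, by rw [zero_smul]; rfl⟩, by simp⟩
    · refine conic_of_mem_blowUpL h (hz (Projectivization.mk ℂ x hx0) ?_) ha hga (cone_mk hx0)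
      rw [Projectivization.submodule_mk, Submodule.span_singleton_le_iff_mem]
      exact hx
  let T : m →ₗ[ℂ] (Fin 2 → ℂ) :=
    (LinearMap.pi ![LinearMap.proj 3, LinearMap.proj 4] : (Fin 5 → ℂ) →ₗ[ℂ] (Fin 2 → ℂ)) ∘ₗ
      m.subtype
  have hT : ∀ x : m, T x = ![x.1 3, x.1 4] := fun x => by
    funext i
    fin_cases i <;> rfl
  have hvertex : joinVec a 0 0 ∈ m := by
    -- If (x₃, x₄) were injective on the two-dimensional m, it would be onto ℂ², and q_a would
    -- vanish identically.
    have hninj : ¬ Function.Injective T := by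
      intro hinj
      have hsurj := (LinearMap.injective_iff_surjective_of_finrank_eq_finrank
        (by rw [hm]; simp)).1 hinj
      obtain ⟨b, c, hbc⟩ := exists_nonisotropic h ha.1 hga
      obtain ⟨x, hx⟩ := hsurj ![b, c]
      rw [hT] at hx
      have h3 : x.1 3 = b := congrFun hx 0
      have h4 : x.1 4 = c := congrFun hx 1
      have := (key x.1 x.2).2
      rw [h3, h4] at this
      exact hbc this
    rw [← LinearMap.ker_eq_bot, Submodule.eq_bot_iff] at hninj
    push Not at hninj
    obtain ⟨x, hx, hx0⟩ := hninj
    rw [LinearMap.mem_ker, hT] at hx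
    have h3 : x.1 3 = 0 := congrFun hx 0
    have h4 : x.1 4 = 0 := congrFun hx 1
    obtain ⟨t, ht⟩ := (key x.1 x.2).1
    have hxe : x.1 = t • joinVec a 0 0 := by
      rw [← joinVec_projL x.1, h3, h4, ht, smul_joinVec, mul_zero]
    have ht0 : t ≠ 0 := by
      rintro rfl
      exact hx0 (Subtype.ext (by rw [hxe, zero_smul]; rfl))
    rw [show joinVec a 0 0 = t⁻¹ • x.1 by rw [hxe, smul_smul, inv_mul_cancel₀ ht0, one_smul]]
    exact m.smul_mem _ x.2
  obtain ⟨w, hw, hwn⟩ : ∃ w ∈ m, w ∉ Submodule.span ℂ {joinVec a 0 0} := by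
    by_contra! hle
    have h1 := Submodule.finrank_mono (show m ≤ Submodule.span ℂ {joinVec a 0 0} from hle)
    rw [hm, finrank_span_singleton (joinVec_ne_zero (Or.inl ha.1))] at h1
    omega
  obtain ⟨⟨t, ht⟩, hq⟩ := key w hw
  have huv : w 3 ≠ 0 ∨ w 4 ≠ 0 := by
    by_contra! h0
    apply hwn
    rw [Submodule.mem_span_singleton]
    exact ⟨t, by rw [← joinVec_projL w, h0.1, h0.2, ht, smul_joinVec, mul_zero]⟩
  have hline : joinVec 0 (w 3) (w 4) ∈ m := by
    have := m.add_mem hw (m.smul_mem (-t) hvertex)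
    rwa [← joinVec_projL w, smul_joinVec, joinVec_add, ht, neg_smul, add_neg_cancel, mul_zero,
      add_zero, add_zero] at this
  obtain ⟨y, hy1, hy2⟩ := exists_root huv hq
  refine ⟨w 3, w 4, y, ha, huv, ?_, hy1, hy2⟩
  refine (Submodule.eq_of_le_of_finrank_eq (Submodule.span_le.2 ?_) ?_).symm
  · rintro x (rfl | rfl)
    · exact hvertex
    · exact hline
  · rw [finrank_span_joinVec_pair ha.1 huv, hm]

/-- Every square root is attained. -/
theorem exists_point (h : IsSmoothNormalForm l₁ l₂ l₃ g) {a : Fin 3 → ℂ} (ha : a ≠ 0)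
    (hga : eval a g = 0) {y : ℂ} (hy : y ^ 2 = eval a (l₁ * l₂ - l₃ ^ 2)) :
    ∃ (z : coverOfCubic l₁ l₂ l₃ g) (u v : ℂ), IsRep z a u v y := by
  have hy' : y ^ 2 = eval a l₁ * eval a l₂ - eval a l₃ ^ 2 := by simpa using hy
  have hI := Complex.I_sq
  obtain ⟨b, c, hbc⟩ := exists_nonisotropic h ha hga
  -- The kernel vector of `IsRep.recover`. It is non-zero since c u - b v is the value of q_a at (b,
  -- c).
  set u := eval a l₃ * b + eval a l₂ * c - Complex.I * b * y with hu
  set v := -(eval a l₁ * b + eval a l₃ * c + Complex.I * c * y) with hv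
  have huv : u ≠ 0 ∨ v ≠ 0 := by
    by_contra! h0
    apply hbc
    rw [hu, hv] at h0
    linear_combination c * h0.1 - b * h0.2
  have e1 : eval a l₁ * u + eval a l₃ * v = Complex.I * y * v := by
    rw [hu, hv]
    linear_combination (-c) * hy' + c * y ^ 2 * hI
  have e2 : eval a l₃ * u + eval a l₂ * v = -(Complex.I * y * u) := by
    rw [hu, hv]
    linear_combination b * hy' - b * y ^ 2 * hI
  have hq : eval a l₁ * u ^ 2 + eval a l₂ * v ^ 2 + 2 * eval a l₃ * u * v = 0 := by
    linear_combination u * e1 + v * e2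
  have hC : Projectivization.mk ℂ a ha ∈ hypersurface g :=
    (mem_hypersurface_iff h.hg (cone_mk ha)).2 hga
  refine ⟨⟨⟨Projectivization.mk ℂ a ha, Submodule.span ℂ {joinVec a 0 0, joinVec 0 u v},
    finrank_span_joinVec_pair ha huv⟩, ⟨?_, fun x hx => ?_⟩, hC⟩, u, v,
    cone_mk ha, huv, rfl, e1, e2⟩
  · rw [discriminantCurve_eq h]
    exact Or.inl hC
  · obtain ⟨w, hw⟩ := (HomCoords.projSpace_wellFormed 5).nonempty x
    obtain ⟨s, t, rfl⟩ := mem_span_joinVec_pair.1 (hx hw.2)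
    exact mem_blowUpL_of_conic h (cone_mk ha) hga hw (by linear_combination t ^ 2 * hq)

end Representatives

/-! ### Plücker coordinates versus the coordinates (a, y) -/

section Coordinates

variable {l₁ l₂ l₃ g : MvPolynomial (Fin 3) ℂ}

/-- Weight one coordinates on the double cover: the coordinates of the image point together with
the square root of `l₁ l₂ - l₃²`. -/
noncomputable def rootCoords (l₁ l₂ l₃ g : MvPolynomial (Fin 3) ℂ) :
    HomCoords (coverOfCubic l₁ l₂ l₃ g) (Fin 3 ⊕ Unit) ℤ where
  wt := fun _ => 1
  cone z := {w | ∃ u v, IsRep z (w ∘ Sum.inl) u v (w (Sum.inr ()))}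

/-- Coordinates in `ℙ² × G(2, 5)` of the point `([a], m)`, where the line `m` is spanned by
`(a, 0, 0)` and `(0, u, v)`. -/
def coverVec (a : Fin 3 → ℂ) (u v : ℂ) : Fin 3 ⊕ Fin 5 × Fin 5 → ℂ :=
  Sum.elim a fun ij => joinVec a 0 0 ij.1 * joinVec 0 u v ij.2 -
    joinVec a 0 0 ij.2 * joinVec 0 u v ij.1

theorem rootCoords_wellFormed (h : IsSmoothNormalForm l₁ l₂ l₃ g) :
    (rootCoords l₁ l₂ l₃ g).WellFormed := by
  refine HomCoords.wellFormed_of_scaling (fun _ => rfl) (fun z => ?_) fun z => ?_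
  · obtain ⟨a, ha⟩ := (HomCoords.projSpace_wellFormed 3).nonempty z.1.1
    obtain ⟨u, v, y, hr⟩ := exists_isRep h z ha
    exact ⟨Sum.elim a fun _ => y, u, v, hr⟩
  · rintro w ⟨u, v, hr⟩ w' ⟨u', v', hr'⟩
    obtain ⟨c, hc⟩ := (mem_submodule_iff_of_cone hr.mem_cone).1 hr'.mem_cone.2
    have hc0 : c ≠ 0 := by
      rintro rfl
      exact hr'.mem_cone.1 (by rw [hc, zero_smul])
    rw [hc] at hr'
    refine ⟨c, hc0, funext fun i => ?_⟩
    rcases i with i | i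
    · exact congrFun hc i
    · exact hr.root_smul h hc0 hr'

theorem coverOfCubicCoords_wellFormed : (coverOfCubicCoords l₁ l₂ l₃ g).WellFormed :=
  ((HomCoords.projSpace_wellFormed 3).prod HomCoords.grassmannian_wellFormed).restrict _

theorem cubicCoords_wellFormed (g : MvPolynomial (Fin 3) ℂ) : (cubicCoords g).WellFormed :=
  (HomCoords.projSpace_wellFormed 3).restrict _

/-- The scale of the Plücker vector, independent of that of a, is absorbed into (u, v). -/
theorem mem_cone_cover_iff (h : IsSmoothNormalForm l₁ l₂ l₃ g) {z : coverOfCubic l₁ l₂ l₃ g}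
    {w : Fin 3 ⊕ Fin 5 × Fin 5 → ℂ} :
    w ∈ (coverOfCubicCoords l₁ l₂ l₃ g).cone z ↔
      ∃ a u v y, IsRep z a u v y ∧ w = coverVec a u v := by
  have hmem : ∀ {a u v y}, IsRep z a u v y →
      (fun ij => coverVec a u v (Sum.inr ij)) ∈ grassmannian.cone z.1.2 := fun {a u v y} hr =>
    ⟨_, _, linearIndependent_joinVec_pair hr.mem_cone.1 hr.ne_zero, hr.span.symm, rfl⟩
  constructor
  · rintro ⟨ha, hω⟩
    obtain ⟨u, v, y, hr⟩ := exists_isRep h z ha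
    obtain ⟨c, hc⟩ := HomCoords.grassmannian_wellFormed.torus _ _ (hmem hr) _ hω
    let c' : ℂ := (c (Multiplicative.ofAdd 1) : ℂˣ)
    refine ⟨_, c' * u, c' * v, y, hr.smul_kernel (Units.ne_zero _), funext fun i => ?_⟩
    rcases i with i | ij
    · rfl
    · have h1 := congrFun hc ij
      rw [h1]
      have h2 : joinVec 0 (c' * u) (c' * v) = c' • joinVec 0 u v := by
        rw [smul_joinVec, smul_zero]
      simp only [coverVec, Sum.elim_inr, h2, Pi.smul_apply, smul_eq_mul]
      change c' * _ = _
      ring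
  · rintro ⟨a, u, v, y, hr, rfl⟩
    exact ⟨hr.mem_cone, hmem hr⟩

/-- If aᵢ ≠ 0, the Plücker coordinates (i, 3) and (i, 4) are aᵢu and aᵢv, which gives the ratio u :
v. Then y is i(l₃u + l₂v)/u or -i(l₁u + l₃v)/v. It has degree one in a and zero in the Plücker
vector, whence the grading map `inl`. -/
theorem locallyRational_cover_root (h : IsSmoothNormalForm l₁ l₂ l₃ g) :
    HomCoords.LocallyRational (coverOfCubicCoords l₁ l₂ l₃ g) (rootCoords l₁ l₂ l₃ g) id := by
  have h5 : 3 ≤ 5 := by norm_num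
  set H := coverOfCubicCoords l₁ l₂ l₃ g with hH
  have hwt : H.wt = Sum.elim (fun _ => ((1 : ℤ), (0 : ℤ))) (fun _ => ((0 : ℤ), (1 : ℤ))) := rfl
  have hl : ∀ {l : MvPolynomial (Fin 3) ℂ}, l.IsHomogeneous 1 →
      IsWeightedHomogeneous H.wt (rename Sum.inl l) ((1 : ℤ), (0 : ℤ)) := fun hl => by
    have := hl.rename_isWeightedHomogeneous (Sum.inl : Fin 3 → Fin 3 ⊕ Fin 5 × Fin 5)
      (w := H.wt) (m := ((1 : ℤ), (0 : ℤ))) fun _ => rfl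
    simpa using this
  have hL : ∀ j, IsWeightedHomogeneous H.wt (X (Sum.inl j)) ((1 : ℤ), (0 : ℤ)) := fun j =>
    isWeightedHomogeneous_X ℂ H.wt (Sum.inl j)
  have hR : ∀ j, IsWeightedHomogeneous H.wt (X (Sum.inr j)) ((0 : ℤ), (1 : ℤ)) := fun j =>
    isWeightedHomogeneous_X ℂ H.wt (Sum.inr j)
  have hI := Complex.I_sq
  refine ⟨AddMonoidHom.inl ℤ ℤ, fun z₀ => ?_⟩
  obtain ⟨a₀, ha₀⟩ := (HomCoords.projSpace_wellFormed 3).nonempty z₀.1.1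
  obtain ⟨u₀, v₀, y₀, hr₀⟩ := exists_isRep h z₀ ha₀
  obtain ⟨i, hi⟩ := Function.ne_iff.1 ha₀.1
  simp only [Pi.zero_apply] at hi
  have h3 : ∀ a u v, coverVec a u v (Sum.inr (Fin.castLE h5 i, 3)) = a i * u := fun a u v => by
    simp [coverVec]
  have h4 : ∀ a u v, coverVec a u v (Sum.inr (Fin.castLE h5 i, 4)) = a i * v := fun a u v => by
    simp [coverVec]
  have h0 : ∀ a u v, coverVec a u v ∘ Sum.inl = a := fun a u v => rfl
  have hmem : coverVec a₀ u₀ v₀ ∈ H.cone z₀ := (mem_cone_cover_iff h).2 ⟨_, _, _, _, hr₀, rfl⟩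
  rcases hr₀.ne_zero with hu | hv
  · refine ⟨((0 : ℤ), (1 : ℤ)), X (Sum.inr (Fin.castLE h5 i, 3)),
      Sum.elim (fun j => X (Sum.inl j) * X (Sum.inr (Fin.castLE h5 i, 3)))
        (fun _ => C Complex.I * (rename Sum.inl l₂ * X (Sum.inr (Fin.castLE h5 i, 4)) +
          rename Sum.inl l₃ * X (Sum.inr (Fin.castLE h5 i, 3)))), hR _, ?_, ?_, ?_⟩
    · rintro (j | j)
      · exact (hL j).mul (hR _)
      · exact (((hl h.hl₂).mul (hR _)).add ((hl h.hl₃).mul (hR _))).C_mul _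
    · intro x hx
      refine coverOfCubicCoords_wellFormed.eval_ne_zero hmem hx (hR _) ?_
      rw [eval_X, h3]
      exact mul_ne_zero hi hu
    · intro z x hx hD
      obtain ⟨a, u, v, y, hr, rfl⟩ := (mem_cone_cover_iff h).1 hx
      rw [eval_X, h3] at hD
      have hai := left_ne_zero_of_mul hD
      have hu' := right_ne_zero_of_mul hD
      refine ⟨u, v, ?_⟩
      change IsRep z _ u v _
      convert hr using 1
      · funext j
        simp only [Function.comp_apply, Sum.elim_inl, map_mul, eval_X, h3]
        rw [mul_div_assoc, div_self hD, mul_one]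
        rfl
      · simp only [Sum.elim_inr, map_mul, map_add, eval_X, eval_C, h3, h4, eval_rename, h0]
        field_simp
        linear_combination Complex.I * hr.eq₂ - y * u * hI
  · refine ⟨((0 : ℤ), (1 : ℤ)), X (Sum.inr (Fin.castLE h5 i, 4)),
      Sum.elim (fun j => X (Sum.inl j) * X (Sum.inr (Fin.castLE h5 i, 4)))
        (fun _ => C (-Complex.I) * (rename Sum.inl l₁ * X (Sum.inr (Fin.castLE h5 i, 3)) +
          rename Sum.inl l₃ * X (Sum.inr (Fin.castLE h5 i, 4)))), hR _, ?_, ?_, ?_⟩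
    · rintro (j | j)
      · exact (hL j).mul (hR _)
      · exact (((hl h.hl₁).mul (hR _)).add ((hl h.hl₃).mul (hR _))).C_mul _
    · intro x hx
      refine coverOfCubicCoords_wellFormed.eval_ne_zero hmem hx (hR _) ?_
      rw [eval_X, h4]
      exact mul_ne_zero hi hv
    · intro z x hx hD
      obtain ⟨a, u, v, y, hr, rfl⟩ := (mem_cone_cover_iff h).1 hx
      rw [eval_X, h4] at hD
      have hai := left_ne_zero_of_mul hD
      have hv' := right_ne_zero_of_mul hD
      refine ⟨u, v, ?_⟩
      change IsRep z _ u v _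
      convert hr using 1
      · funext j
        simp only [Function.comp_apply, Sum.elim_inl, map_mul, eval_X, h4]
        rw [mul_div_assoc, div_self hD, mul_one]
        rfl
      · simp only [Sum.elim_inr, map_mul, map_add, eval_X, eval_C, h3, h4, eval_rename, h0]
        field_simp
        linear_combination -Complex.I * hr.eq₁ - y * v * hI

theorem MvPolynomial.IsHomogeneous.rename_inl_isWeightedHomogeneous {σ : Type} {p : MvPolynomial (Fin 3) ℂ}
    {n : ℕ} (hp : p.IsHomogeneous n) :
    IsWeightedHomogeneous (fun _ => (1 : ℤ)) (rename (Sum.inl : Fin 3 → Fin 3 ⊕ σ) p) (n : ℤ) := by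
  simpa using hp.rename_isWeightedHomogeneous (Sum.inl : Fin 3 → Fin 3 ⊕ σ)
    (w := fun _ => (1 : ℤ)) (m := 1) fun _ => rfl

/-- A vector (b, c) that is non-isotropic at one point stays so nearby, and `IsRep.recover` then
gives (u, v) as linear forms in (a, y). The denominator D is the value of the form at (b, c). -/
theorem locallyRational_root_cover (h : IsSmoothNormalForm l₁ l₂ l₃ g) :
    HomCoords.LocallyRational (rootCoords l₁ l₂ l₃ g) (coverOfCubicCoords l₁ l₂ l₃ g) id := by
  set H := rootCoords l₁ l₂ l₃ g with hH
  have hl : ∀ {l : MvPolynomial (Fin 3) ℂ}, l.IsHomogeneous 1 →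
      IsWeightedHomogeneous H.wt (rename Sum.inl l) (1 : ℤ) :=
    fun hl => MvPolynomial.IsHomogeneous.rename_inl_isWeightedHomogeneous hl
  have hX : ∀ j, IsWeightedHomogeneous H.wt (X j) (1 : ℤ) := fun j =>
    isWeightedHomogeneous_X ℂ H.wt j
  -- Plücker coordinates are quadratic in (a, y) before division by the linear D, so both weights
  -- (1, 0) and (0, 1) go to 1.
  refine ⟨AddMonoidHom.coprod (AddMonoidHom.id ℤ) (AddMonoidHom.id ℤ), fun z₀ => ?_⟩
  obtain ⟨a₀, ha₀⟩ := (HomCoords.projSpace_wellFormed 3).nonempty z₀.1.1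
  obtain ⟨u₀, v₀, y₀, hr₀⟩ := exists_isRep h z₀ ha₀
  obtain ⟨b, c, hbc⟩ := exists_nonisotropic h ha₀.1 hr₀.eval_cubic
  let D : MvPolynomial (Fin 3 ⊕ Unit) ℂ := C (b ^ 2) * rename Sum.inl l₁ +
    C (c ^ 2) * rename Sum.inl l₂ + C (2 * b * c) * rename Sum.inl l₃
  let U : MvPolynomial (Fin 3 ⊕ Unit) ℂ := C b * rename Sum.inl l₃ + C c * rename Sum.inl l₂ -
    C (Complex.I * b) * X (Sum.inr ())
  let V : MvPolynomial (Fin 3 ⊕ Unit) ℂ := -(C b * rename Sum.inl l₁ + C c * rename Sum.inl l₃ +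
    C (Complex.I * c) * X (Sum.inr ()))
  let A : Fin 5 → MvPolynomial (Fin 3 ⊕ Unit) ℂ :=
    ![X (Sum.inl 0), X (Sum.inl 1), X (Sum.inl 2), 0, 0]
  let W : Fin 5 → MvPolynomial (Fin 3 ⊕ Unit) ℂ := ![0, 0, 0, U, V]
  have hD : IsWeightedHomogeneous H.wt D (1 : ℤ) :=
    (((hl h.hl₁).C_mul _).add ((hl h.hl₂).C_mul _)).add ((hl h.hl₃).C_mul _)
  have hU : IsWeightedHomogeneous H.wt U (1 : ℤ) :=
    (((hl h.hl₃).C_mul _).add ((hl h.hl₂).C_mul _)).sub ((hX _).C_mul _)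
  have hV : IsWeightedHomogeneous H.wt V (1 : ℤ) :=
    ((((hl h.hl₁).C_mul _).add ((hl h.hl₃).C_mul _)).add ((hX _).C_mul _)).neg
  have h0 := isWeightedHomogeneous_zero ℂ H.wt (1 : ℤ)
  have hA : ∀ i, IsWeightedHomogeneous H.wt (A i) (1 : ℤ) := fun i => by
    fin_cases i
    exacts [hX _, hX _, hX _, h0, h0]
  have hW : ∀ i, IsWeightedHomogeneous H.wt (W i) (1 : ℤ) := fun i => by
    fin_cases i
    exacts [h0, h0, h0, hU, hV]
  have hAe : ∀ i x, eval x (A i) = joinVec (x ∘ Sum.inl) 0 0 i := fun i x => by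
    fin_cases i <;> simp [A, joinVec]
  have hWe : ∀ i x, eval x (W i) = joinVec 0 (eval x U) (eval x V) i := fun i x => by
    fin_cases i <;> simp [W, joinVec]
  have hDe : ∀ x, eval x D = eval (x ∘ Sum.inl) l₁ * b ^ 2 + eval (x ∘ Sum.inl) l₂ * c ^ 2 +
      2 * eval (x ∘ Sum.inl) l₃ * b * c := fun x => by
    simp only [D, map_add, map_mul, eval_C, eval_rename]
    ring
  have hUe : ∀ x, eval x U = eval (x ∘ Sum.inl) l₃ * b + eval (x ∘ Sum.inl) l₂ * c -
      Complex.I * b * x (Sum.inr ()) := fun x => by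
    simp only [U, map_add, map_sub, map_mul, eval_C, eval_rename, eval_X]
    ring
  have hVe : ∀ x, eval x V = -(eval (x ∘ Sum.inl) l₁ * b + eval (x ∘ Sum.inl) l₃ * c +
      Complex.I * c * x (Sum.inr ())) := fun x => by
    simp only [V, map_add, map_neg, map_mul, eval_C, eval_rename, eval_X]
    ring
  refine ⟨(1 : ℤ), D, Sum.elim (fun j => X (Sum.inl j) * D)
    (fun ij => A ij.1 * W ij.2 - A ij.2 * W ij.1), hD, ?_, ?_, ?_⟩
  · rintro (j | ij)
    · exact (hX _).mul hD
    · exact ((hA _).mul (hW _)).sub ((hA _).mul (hW _))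
  · intro x hx
    refine (rootCoords_wellFormed h).eval_ne_zero (x := Sum.elim a₀ fun _ => y₀)
      ⟨_, _, hr₀⟩ hx hD ?_
    rw [hDe]
    exact hbc
  · rintro z x ⟨u, v, hr⟩ hDx
    have hr' := hr.recover (b := b) (c := c) (by rwa [← hDe])
    rw [← hUe, ← hVe] at hr'
    refine (mem_cone_cover_iff h).2
      ⟨_, _, _, _, hr'.smul_kernel (inv_ne_zero hDx), funext fun i => ?_⟩
    rcases i with i | ij
    · simp only [Sum.elim_inl, map_mul, eval_X]
      rw [mul_div_assoc, div_self hDx, mul_one]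
      rfl
    · have h2 : joinVec 0 ((eval x D)⁻¹ * eval x U) ((eval x D)⁻¹ * eval x V) =
          (eval x D)⁻¹ • joinVec 0 (eval x U) (eval x V) := by
        rw [smul_joinVec, smul_zero]
      simp only [coverVec, Sum.elim_inr, h2, Pi.smul_apply, smul_eq_mul, map_sub, map_mul, hAe,
        hWe]
      field_simp

theorem locallyRational_root_cubic :
    HomCoords.LocallyRational (rootCoords l₁ l₂ l₃ g) (cubicCoords g) (coverMap l₁ l₂ l₃ g) := by
  refine ⟨AddMonoidHom.id ℤ, fun z₀ => ⟨0, 1, fun j => X (Sum.inl j),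
    isWeightedHomogeneous_one _ _, fun j => isWeightedHomogeneous_X ℂ _ _, by simp, ?_⟩⟩
  rintro z x ⟨u, v, hr⟩ -
  simp only [eval_X, map_one, div_one]
  exact hr.mem_cone

theorem isMorphism_cover_root (h : IsSmoothNormalForm l₁ l₂ l₃ g) :
    HomCoords.IsMorphism (coverOfCubicCoords l₁ l₂ l₃ g) (rootCoords l₁ l₂ l₃ g) id :=
  (locallyRational_cover_root h).isMorphism coverOfCubicCoords_wellFormed (rootCoords_wellFormed h)

theorem isMorphism_root_cover (h : IsSmoothNormalForm l₁ l₂ l₃ g) :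
    HomCoords.IsMorphism (rootCoords l₁ l₂ l₃ g) (coverOfCubicCoords l₁ l₂ l₃ g) id :=
  (locallyRational_root_cover h).isMorphism (rootCoords_wellFormed h) coverOfCubicCoords_wellFormed

theorem isMorphism_coverMap (h : IsSmoothNormalForm l₁ l₂ l₃ g) :
    HomCoords.IsMorphism (coverOfCubicCoords l₁ l₂ l₃ g) (cubicCoords g)
      (coverMap l₁ l₂ l₃ g) :=
  (locallyRational_root_cubic.isMorphism (rootCoords_wellFormed h)
    (cubicCoords_wellFormed g)).comp (isMorphism_cover_root h)

/-- The two systems of coordinates on the double cover have the same regular functions. -/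
theorem mem_regular_cover_iff (h : IsSmoothNormalForm l₁ l₂ l₃ g)
    {V : Set (hypersurface g)} (hV : IsOpen[(cubicCoords g).zariski] V)
    {f : (coverMap l₁ l₂ l₃ g ⁻¹' V : Set _) → ℂ} :
    f ∈ (coverOfCubicCoords l₁ l₂ l₃ g).regular (coverMap l₁ l₂ l₃ g ⁻¹' V) ↔
      f ∈ (rootCoords l₁ l₂ l₃ g).regular (coverMap l₁ l₂ l₃ g ⁻¹' V) := by
  constructor
  · refine (isMorphism_root_cover h).2 _ ?_ f
    exact @IsOpen.preimage _ _ (_) (_) _ (isMorphism_coverMap h).1 _ hV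
  · refine (isMorphism_cover_root h).2 _ ?_ f
    exact @IsOpen.preimage _ _ (_) (_) _ (locallyRational_root_cubic.isMorphism
      (rootCoords_wellFormed h) (cubicCoords_wellFormed g)).1 _ hV

end Coordinates

/-! ### Affine charts -/

section Charts

namespace HomCoords

theorem isClosed_affine_vanishing {n : ℕ} (P : MvPolynomial (Fin n) ℂ) :
    IsClosed[(affineSpace n).zariski] {x | eval x P = 0} := by
  have := (affineSpace_wellFormed n).isClosed_vanishing (B := P) (k := 0)
    (isWeightedHomogeneous_of_weight_zero P)
  convert this using 1
  ext x
  exact ⟨fun h y hy => by rwa [show y = x from hy], fun h => h x rfl⟩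

theorem IsAffine.of_isMorphism_id {Y σ M σ' M' : Type} [AddCommGroup M] [AddCommGroup M']
    {H : HomCoords Y σ M} {H' : HomCoords Y σ' M'} (h : IsAffine H) (h₁ : IsMorphism H' H id)
    (h₂ : IsMorphism H H' id) : IsAffine H' := by
  obtain ⟨n, Z, hZ, e, he, he'⟩ := h
  exact ⟨n, Z, hZ, e, he.comp h₁, h₂.comp he'⟩

end HomCoords

variable {l₁ l₂ l₃ g : MvPolynomial (Fin 3) ℂ}

/-- The part of the cubic curve where the `i`-th coordinate does not vanish. -/
def cubicChart (g : MvPolynomial (Fin 3) ℂ) (i : Fin 3) : Set (hypersurface g) :=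
  {p | ∀ x ∈ (cubicCoords g).cone p, eval x (X i) ≠ 0}

theorem isOpen_cubicChart (g : MvPolynomial (Fin 3) ℂ) (i : Fin 3) :
    IsOpen[(cubicCoords g).zariski] (cubicChart g i) :=
  (cubicCoords g).isOpen_nonvanishing (isWeightedHomogeneous_X ℂ _ i)

theorem mem_cubicChart_iff {i : Fin 3} {p : hypersurface g} {a : Fin 3 → ℂ}
    (ha : a ∈ (cubicCoords g).cone p) : p ∈ cubicChart g i ↔ a i ≠ 0 := by
  refine ⟨fun h => by simpa using h a ha, fun h x hx => ?_⟩
  exact (cubicCoords_wellFormed g).eval_ne_zero ha hx (isWeightedHomogeneous_X ℂ _ i) (by simpa)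

/-- Normalising xᵢ = 1 identifies the chart with V(xᵢ - 1, g) in 𝔸³. -/
theorem isAffine_cubicChart (hg : g.IsHomogeneous 3) (i : Fin 3) :
    HomCoords.IsAffine ((cubicCoords g).restrict (cubicChart g i)) := by
  let Z : Set (Fin 3 → ℂ) := {w | eval w (X i - 1) = 0} ∩ {w | eval w g = 0}
  have hZ1 : ∀ w : Z, w.1 i = 1 := fun w => by
    have := w.2.1
    simp only [Set.mem_ofPred_eq, map_sub, eval_X, map_one] at this
    linear_combination this
  have hZ0 : ∀ w : Z, w.1 ≠ 0 := fun w e => by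
    have := hZ1 w
    rw [e] at this
    simp at this
  let f : Z → cubicChart g i := fun w => ⟨⟨Projectivization.mk ℂ w.1 (hZ0 w),
    (mem_hypersurface_iff hg (cone_mk (hZ0 w))).2 w.2.2⟩,
    (mem_cubicChart_iff (cone_mk (hZ0 w))).2 (by rw [hZ1 w]; exact one_ne_zero)⟩
  have hf : ∀ w, w.1 ∈ ((cubicCoords g).restrict (cubicChart g i)).cone (f w) := fun w =>
    cone_mk (hZ0 w)
  have huniq : ∀ (w : Z) (p) (x), w.1 ∈ ((cubicCoords g).restrict (cubicChart g i)).cone p →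
      x ∈ ((cubicCoords g).restrict (cubicChart g i)).cone p → (fun j => x j / x i) = w.1 := by
    intro w p x hw hx
    obtain ⟨c, hc⟩ := (mem_submodule_iff_of_cone hw).1 hx.2
    have hc0 : c ≠ 0 := by
      rintro rfl
      exact hx.1 (by rw [hc, zero_smul])
    funext j
    simp only [hc, Pi.smul_apply, smul_eq_mul, hZ1 w]
    field_simp
  have hbij : Function.Bijective f := by
    constructor
    · intro w w' hww
      apply Subtype.ext
      have hw' := hf w'
      rw [← hww] at hw'
      rw [← huniq w' _ _ hw' (hf w)]
      funext j
      rw [hZ1 w, div_one]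
    · rintro ⟨p, hp⟩
      obtain ⟨a, ha⟩ := (cubicCoords_wellFormed g).nonempty p
      have hai := (mem_cubicChart_iff ha).1 hp
      have ha' : (a i)⁻¹ • a ∈ (cubicCoords g).cone p := smul_mem_cone ha (inv_ne_zero hai)
      refine ⟨⟨(a i)⁻¹ • a, ?_, p.2 _ ha'.2⟩, ?_⟩
      · simp [hai]
      · exact Subtype.ext (Subtype.ext (eq_of_mem_cone (cone_mk _) ha'))
  have hwf := (cubicCoords_wellFormed g).restrict (cubicChart g i)
  have hwf' := (HomCoords.affineSpace_wellFormed 3).restrict Z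
  refine ⟨3, Z, ?_, (Equiv.ofBijective f hbij).symm, ?_, ?_⟩
  · let _ := (HomCoords.affineSpace 3).zariski
    exact (HomCoords.isClosed_affine_vanishing _).inter (HomCoords.isClosed_affine_vanishing _)
  · refine HomCoords.LocallyRational.isMorphism hwf hwf' ⟨0, fun p₀ => ⟨1, X i, X,
      isWeightedHomogeneous_X ℂ _ i, fun j => isWeightedHomogeneous_X ℂ _ j, p₀.2, ?_⟩⟩
    intro p x hx _
    simp only [eval_X]
    refine huniq _ p x ?_ hx
    have := hf ((Equiv.ofBijective f hbij).symm p)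
    rwa [Equiv.ofBijective_apply_symm_apply f hbij p] at this
  · refine HomCoords.LocallyRational.isMorphism hwf' hwf ⟨0, fun p₀ => ⟨0, 1, X,
      isWeightedHomogeneous_one _ _, fun j => isWeightedHomogeneous_X ℂ _ j, by simp, ?_⟩⟩
    rintro w x hx -
    rw [show x = w.1 from hx]
    simp only [eval_X, map_one, div_one]
    exact hf w

/-- In the coordinates (a, y) the chart is V(xᵢ - 1, g, y² - s) in 𝔸⁴. Each point there comes from
the cover by `exists_point`, and `IsRep.point_unique` makes the map onto. -/
theorem isAffine_rootChart (h : IsSmoothNormalForm l₁ l₂ l₃ g) (i : Fin 3) :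
    HomCoords.IsAffine
      ((rootCoords l₁ l₂ l₃ g).restrict (coverMap l₁ l₂ l₃ g ⁻¹' cubicChart g i)) := by
  set W := coverMap l₁ l₂ l₃ g ⁻¹' cubicChart g i
  set H := (rootCoords l₁ l₂ l₃ g).restrict W
  let Z : Set (Fin 4 → ℂ) := {w | eval w (X i.castSucc - 1) = 0} ∩
    {w | eval w (rename Fin.castSucc g) = 0} ∩
    {w | eval w (X (Fin.last 3) ^ 2 - rename Fin.castSucc (l₁ * l₂ - l₃ ^ 2)) = 0}
  have hZ1 : ∀ w : Z, w.1 i.castSucc = 1 := fun w => by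
    have := w.2.1.1
    simp only [Set.mem_ofPred_eq, map_sub, eval_X, map_one] at this
    linear_combination this
  have hZ0 : ∀ w : Z, w.1 ∘ Fin.castSucc ≠ 0 := fun w e => by
    have h0 := congrFun e i
    simp [hZ1 w] at h0
  have hex : ∀ w : Z, ∃ (z : coverOfCubic l₁ l₂ l₃ g) (u v : ℂ),
      IsRep z (w.1 ∘ Fin.castSucc) u v (w.1 (Fin.last 3)) := fun w => by
    refine exists_point h (hZ0 w) ?_ ?_
    · have := w.2.1.2
      simpa only [Set.mem_ofPred_eq, eval_rename] using this
    · have := w.2.2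
      rw [Set.mem_ofPred_eq, map_sub, map_pow, eval_X, eval_rename] at this
      linear_combination this
  choose f₀ hf₀ using hex
  let f : Z → W := fun w => ⟨f₀ w, by
    obtain ⟨u, v, hr⟩ := hf₀ w
    refine (mem_cubicChart_iff (p := coverMap l₁ l₂ l₃ g (f₀ w)) hr.mem_cone).2 ?_
    change w.1 i.castSucc ≠ 0
    rw [hZ1 w]
    exact one_ne_zero⟩
  have hf : ∀ w, Sum.elim (w.1 ∘ Fin.castSucc) (fun _ => w.1 (Fin.last 3)) ∈ H.cone (f w) := hf₀
  let N : (Fin 3 ⊕ Unit → ℂ) → Fin 4 → ℂ := fun x =>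
    Fin.snoc (α := fun _ => ℂ) (fun j => x (Sum.inl j) / x (Sum.inl i))
      (x (Sum.inr ()) / x (Sum.inl i))
  have huniq : ∀ (w : Z) (z) (x),
      Sum.elim (w.1 ∘ Fin.castSucc) (fun _ => w.1 (Fin.last 3)) ∈ H.cone z →
      x ∈ H.cone z → N x = w.1 := by
    rintro w z x ⟨u, v, hr⟩ ⟨u', v', hr'⟩
    obtain ⟨c, hc⟩ := (mem_submodule_iff_of_cone hr.mem_cone).1 hr'.mem_cone.2
    have hc0 : c ≠ 0 := by
      rintro rfl
      exact hr'.mem_cone.1 (by rw [hc, zero_smul])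
    rw [hc] at hr'
    have hy := hr.root_smul h hc0 hr'
    have hx : ∀ j, x (Sum.inl j) = c * w.1 j.castSucc := fun j => congrFun hc j
    funext j
    refine Fin.lastCases ?_ (fun j => ?_) j
    · simp only [N, Fin.snoc_last, hx, hZ1 w, hy, Sum.elim_inr]
      field_simp
    · simp only [N, Fin.snoc_castSucc, hx, hZ1 w]
      field_simp
  have hbij : Function.Bijective f := by
    constructor
    · intro w w' hww
      apply Subtype.ext
      have hw' := hf w'
      rw [← hww] at hw'
      rw [← huniq w' _ _ hw' (hf w)]
      funext j
      refine Fin.lastCases ?_ (fun j => ?_) j <;>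
        simp only [N, Fin.snoc_last, Fin.snoc_castSucc, Sum.elim_inl, Sum.elim_inr,
          Function.comp_apply, hZ1 w, div_one]
    · rintro ⟨z, hz⟩
      obtain ⟨a, ha⟩ := (HomCoords.projSpace_wellFormed 3).nonempty z.1.1
      obtain ⟨u, v, y, hr⟩ := exists_isRep h z ha
      have hai := (mem_cubicChart_iff (p := coverMap l₁ l₂ l₃ g z) ha).1 hz
      have hr' := hr.smul_point h (inv_ne_zero hai)
      have hcomp : (Fin.snoc (α := fun _ => ℂ) ((a i)⁻¹ • a) ((a i)⁻¹ * y) : Fin 4 → ℂ) ∘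
          Fin.castSucc = (a i)⁻¹ • a := funext fun j => Fin.snoc_castSucc ..
      let w : Z := ⟨Fin.snoc (α := fun _ => ℂ) ((a i)⁻¹ • a) ((a i)⁻¹ * y), by
        refine ⟨⟨?_, ?_⟩, ?_⟩
        · rw [Set.mem_ofPred_eq, map_sub, eval_X, map_one, Fin.snoc_castSucc]
          simp [hai]
        · rw [Set.mem_ofPred_eq, eval_rename, hcomp]
          exact hr'.eval_cubic
        · rw [Set.mem_ofPred_eq, map_sub, map_pow, eval_X, eval_rename, hcomp, Fin.snoc_last,
            hr'.sq_eq, sub_self]⟩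
      refine ⟨w, Subtype.ext ?_⟩
      obtain ⟨u', v', hw⟩ := hf₀ w
      have hlast : w.1 (Fin.last 3) = (a i)⁻¹ * y := by simp only [w, Fin.snoc_last]
      rw [show w.1 ∘ Fin.castSucc = _ from hcomp, hlast] at hw
      exact hr'.point_unique h hw
  have hwf : H.WellFormed := (rootCoords_wellFormed h).restrict W
  have hwf' := (HomCoords.affineSpace_wellFormed 4).restrict Z
  refine ⟨4, Z, ?_, (Equiv.ofBijective f hbij).symm, ?_, ?_⟩
  · let _ := (HomCoords.affineSpace 4).zariski
    exact ((HomCoords.isClosed_affine_vanishing _).inter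
      (HomCoords.isClosed_affine_vanishing _)).inter (HomCoords.isClosed_affine_vanishing _)
  · refine HomCoords.LocallyRational.isMorphism hwf hwf' ⟨0, fun p₀ => ⟨1, X (Sum.inl i),
      Fin.snoc (α := fun _ => MvPolynomial (Fin 3 ⊕ Unit) ℂ) (fun j => X (Sum.inl j))
        (X (Sum.inr ())), isWeightedHomogeneous_X ℂ _ _, fun j => ?_, ?_, ?_⟩⟩
    · refine Fin.lastCases ?_ (fun j => ?_) j
      · rw [Fin.snoc_last]
        exact isWeightedHomogeneous_X ℂ _ _
      · rw [Fin.snoc_castSucc]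
        exact isWeightedHomogeneous_X ℂ _ _
    · rintro x ⟨u, v, hr⟩
      rw [eval_X]
      exact (mem_cubicChart_iff (p := coverMap l₁ l₂ l₃ g p₀.1) hr.mem_cone).1 p₀.2
    · intro z x hx _
      have := hf ((Equiv.ofBijective f hbij).symm z)
      rw [Equiv.ofBijective_apply_symm_apply f hbij z] at this
      have hN := huniq _ z x this hx
      change _ = ((Equiv.ofBijective f hbij).symm z).1
      rw [← hN]
      funext j
      refine Fin.lastCases ?_ (fun j => ?_) j <;>
        simp only [N, Fin.snoc_last, Fin.snoc_castSucc, eval_X]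
  · refine HomCoords.LocallyRational.isMorphism hwf' hwf ⟨0, fun p₀ => ⟨0, 1,
      Sum.elim (fun j => X j.castSucc) (fun _ => X (Fin.last 3)),
      isWeightedHomogeneous_one _ _, fun j => isWeightedHomogeneous_of_weight_zero _, by simp, ?_⟩⟩
    rintro w x hx -
    rw [show x = w.1 from hx]
    refine Set.mem_of_eq_of_mem ?_ (hf w)
    funext j
    rcases j with j | j <;> simp

theorem isAffine_coverChart (h : IsSmoothNormalForm l₁ l₂ l₃ g) (i : Fin 3) :
    HomCoords.IsAffine
      ((coverOfCubicCoords l₁ l₂ l₃ g).restrict (coverMap l₁ l₂ l₃ g ⁻¹' cubicChart g i)) :=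
  (isAffine_rootChart h i).of_isMorphism_id
    (((locallyRational_cover_root h).restrict fun _ hy => hy).isMorphism
      (coverOfCubicCoords_wellFormed.restrict _) ((rootCoords_wellFormed h).restrict _))
    (((locallyRational_root_cover h).restrict fun _ hy => hy).isMorphism
      ((rootCoords_wellFormed h).restrict _) (coverOfCubicCoords_wellFormed.restrict _))

end Charts

/-! ### The splitting of the direct image -/

namespace HomCoords

variable {Y σ M : Type} [AddCommGroup M] {H : HomCoords Y σ M}

theorem sections_torus {d : M} {V : Set Y} {s : H.ConeOver V → ℂ} (hs : s ∈ H.sections d V) (y : V) (x x' : H.cone y.1) {c : Multiplicative M →* ℂˣ}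
    (hc : x'.1 = fun i => c (Multiplicative.ofAdd (H.wt i)) * x.1 i) :
    s ⟨y, x'⟩ = c (Multiplicative.ofAdd d) * s ⟨y, x⟩ := by
  obtain ⟨k, A, B, hA, hB, hB0, hAB⟩ := hs y
  rw [hAB ⟨y, x'⟩ (hB0 _ x'.2), hAB ⟨y, x⟩ (hB0 _ x.2)]
  simp only [hc, hA.eval_torus, hB.eval_torus, ofAdd_add, map_mul, Units.val_mul]
  have h1 := hB0 _ x.2
  have h2 := Units.ne_zero (c (Multiplicative.ofAdd k))
  field_simp

theorem mul_mem_sections {d : M} {V : Set Y} {f : V → ℂ} (hf : f ∈ H.regular V)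
    {s : H.ConeOver V → ℂ} (hs : s ∈ H.sections d V) :
    (fun z : H.ConeOver V => f z.1 * s z) ∈ H.sections d V := by
  intro y
  obtain ⟨k, A, B, hA, hB, h0, h⟩ := hf y
  obtain ⟨k', A', B', hA', hB', h0', h'⟩ := hs y
  refine ⟨k + k', A * A', B * B', ?_, hB.mul hB', ?_, ?_⟩
  · have := hA.mul hA'
    rwa [show k + 0 + (k' + d) = k + k' + d by abel] at this
  · intro x hx
    simpa using ⟨h0 x hx, h0' x hx⟩
  · intro z hz
    have hz1 : eval z.2.1 B ≠ 0 := fun e => hz (by simp [e])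
    have hz2 : eval z.2.1 B' ≠ 0 := fun e => hz (by simp [e])
    have e1 := h z hz1
    simp only at e1 ⊢
    rw [e1, h' z hz2, map_mul, map_mul, div_mul_div_comm]

end HomCoords

section DirectImage

variable {l₁ l₂ l₃ g : MvPolynomial (Fin 3) ℂ}

theorem MvPolynomial.IsWeightedHomogeneous.rename_inl {p : MvPolynomial (Fin 3) ℂ} {k : ℤ}
    (hp : IsWeightedHomogeneous (fun _ => (1 : ℤ)) p k) :
    IsWeightedHomogeneous (fun _ => (1 : ℤ)) (rename (Sum.inl : Fin 3 → Fin 3 ⊕ Unit) p) k := by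
  rw [rename_eq_aeval]
  exact hp.aeval_weighted (w' := fun _ => (1 : ℤ)) (AddMonoidHom.id ℤ)
    fun i => isWeightedHomogeneous_X ℂ _ (Sum.inl i)

theorem IsSmoothNormalForm.isWeightedHomogeneous_conic (h : IsSmoothNormalForm l₁ l₂ l₃ g) :
    IsWeightedHomogeneous (fun _ => (1 : ℤ)) (l₁ * l₂ - l₃ ^ 2) 2 := by
  have hQ : (l₁ * l₂ - l₃ ^ 2).IsHomogeneous 2 := (h.hl₁.mul h.hl₂).sub (h.hl₃.pow 2)
  simpa using hQ.isWeightedHomogeneous_const (w := fun _ => (1 : ℤ)) (m := 1) fun _ => rfl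

/-- Modulo `y² = l₁ l₂ - l₃²` every polynomial is linear in `y`. -/
theorem exists_linear_in_root (h : IsSmoothNormalForm l₁ l₂ l₃ g)
    {A : MvPolynomial (Fin 3 ⊕ Unit) ℂ} {n : ℤ}
    (hA : IsWeightedHomogeneous (fun _ => (1 : ℤ)) A n) :
    ∃ α β : MvPolynomial (Fin 3) ℂ, IsWeightedHomogeneous (fun _ => (1 : ℤ)) α n ∧
      IsWeightedHomogeneous (fun _ => (1 : ℤ)) β (n - 1) ∧
      ∀ w : Fin 3 ⊕ Unit → ℂ, w (Sum.inr ()) ^ 2 = eval (w ∘ Sum.inl) (l₁ * l₂ - l₃ ^ 2) →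
        eval w A = eval (w ∘ Sum.inl) α + w (Sum.inr ()) * eval (w ∘ Sum.inl) β := by
  refine isWeightedHomogeneous_closure_induction (w := fun _ : Fin 3 ⊕ Unit => (1 : ℤ))
    (Q := fun A n => ∃ α β : MvPolynomial (Fin 3) ℂ,
      IsWeightedHomogeneous (fun _ => (1 : ℤ)) α n ∧
      IsWeightedHomogeneous (fun _ => (1 : ℤ)) β (n - 1) ∧
      ∀ w : Fin 3 ⊕ Unit → ℂ, w (Sum.inr ()) ^ 2 = eval (w ∘ Sum.inl) (l₁ * l₂ - l₃ ^ 2) →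
        eval w A = eval (w ∘ Sum.inl) α + w (Sum.inr ()) * eval (w ∘ Sum.inl) β)
    ?_ ?_ ?_ ?_ ?_ hA
  · intro m
    exact ⟨0, 0, isWeightedHomogeneous_zero _ _ _, isWeightedHomogeneous_zero _ _ _, by simp⟩
  · intro c
    exact ⟨C c, 0, isWeightedHomogeneous_C _ _, isWeightedHomogeneous_zero _ _ _, by simp⟩
  · rintro (i | i)
    · exact ⟨X i, 0, isWeightedHomogeneous_X ℂ _ i, isWeightedHomogeneous_zero _ _ _, by simp⟩
    · exact ⟨0, 1, isWeightedHomogeneous_zero _ _ _, isWeightedHomogeneous_one _ _, by simp⟩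
  · rintro p q m ⟨α, β, hα, hβ, he⟩ ⟨α', β', hα', hβ', he'⟩
    refine ⟨α + α', β + β', hα.add hα', hβ.add hβ', fun w hw => ?_⟩
    simp only [map_add, he w hw, he' w hw]
    ring
  · rintro p q m n ⟨α, β, hα, hβ, he⟩ ⟨α', β', hα', hβ', he'⟩
    refine ⟨α * α' + β * β' * (l₁ * l₂ - l₃ ^ 2), α * β' + β * α', ?_, ?_, fun w hw => ?_⟩
    · refine (hα.mul hα').add ?_
      have := (hβ.mul hβ').mul h.isWeightedHomogeneous_conic
      rwa [show m - 1 + (n - 1) + 2 = m + n by ring] at this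
    · refine IsWeightedHomogeneous.add ?_ ?_
      · have := hα.mul hβ'
        rwa [show m + (n - 1) = m + n - 1 by ring] at this
      · have := hβ.mul hα'
        rwa [show m - 1 + n = m + n - 1 by ring] at this
    · rw [map_mul, he w hw, he' w hw, map_add, map_add, map_mul, map_mul, map_mul, map_mul,
        map_mul, ← hw]
      ring

/-- Avoidance at two points: it merges denominators valid at the two points of a fibre into one
valid at both. -/
theorem exists_linear_combination_ne_zero {a b c d : ℂ} (ha : a ≠ 0) (hd : d ≠ 0) :
    ∃ s t : ℂ, s * a + t * b ≠ 0 ∧ s * c + t * d ≠ 0 := by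
  by_cases hc : c = 0
  · by_cases hb : b = 0
    · exact ⟨1, 1, by simpa [hb], by simpa [hc]⟩
    · exact ⟨0, 1, by simpa, by simpa⟩
  · exact ⟨1, 0, by simpa, by simpa⟩

/-- A regular function is a quotient of polynomials, with a denominator not vanishing at a given
point, in the sense that `f B = A` everywhere. -/
theorem exists_denominator {V : Set (coverOfCubic l₁ l₂ l₃ g)} {f : V → ℂ}
    (hf : f ∈ (rootCoords l₁ l₂ l₃ g).regular V) (z : V) :
    ∃ (k : ℤ) (A B : MvPolynomial (Fin 3 ⊕ Unit) ℂ),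
      IsWeightedHomogeneous (fun _ => (1 : ℤ)) A k ∧
      IsWeightedHomogeneous (fun _ => (1 : ℤ)) B k ∧
      (∀ w ∈ (rootCoords l₁ l₂ l₃ g).cone z.1, eval w B ≠ 0) ∧
      ∀ z' : V, ∀ w ∈ (rootCoords l₁ l₂ l₃ g).cone z'.1, f z' * eval w B = eval w A := by
  obtain ⟨k, A, B, hA, hB, hB0, hAB⟩ := hf z
  rw [add_zero] at hA
  -- Multiplying through by B makes the identity hold, as 0 = 0, also where B vanishes.
  refine ⟨k + k, A * B, B * B, hA.mul hB, hB.mul hB, fun w hw => ?_, fun z' w hw => ?_⟩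
  · rw [map_mul]
    exact mul_ne_zero (hB0 w hw) (hB0 w hw)
  · rw [map_mul, map_mul]
    by_cases h0 : eval w B = 0
    · rw [h0]
      ring
    · have := hAB ⟨z', w, hw⟩ h0
      simp only at this
      rw [this]
      field_simp

theorem coverMap_eq_of_isRep {z : coverOfCubic l₁ l₂ l₃ g} {a : Fin 3 → ℂ} {u v y : ℂ}
    (hr : IsRep z a u v y) {p : hypersurface g} (ha : a ∈ (cubicCoords g).cone p) :
    coverMap l₁ l₂ l₃ g z = p :=
  Subtype.ext (eq_of_mem_cone hr.mem_cone ha)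

/-- Over a point of the cubic curve, there are points of the cover for both square roots. -/
theorem exists_fibre_points (h : IsSmoothNormalForm l₁ l₂ l₃ g) {p : hypersurface g}
    {a : Fin 3 → ℂ} (ha : a ∈ (cubicCoords g).cone p) {y : ℂ}
    (hy : y ^ 2 = eval a (l₁ * l₂ - l₃ ^ 2)) :
    ∃ (z : coverOfCubic l₁ l₂ l₃ g) (u v : ℂ), IsRep z a u v y ∧ coverMap l₁ l₂ l₃ g z = p := by
  obtain ⟨z, u, v, hr⟩ := exists_point h ha.1 (p.2 a ha.2) hy
  exact ⟨z, u, v, hr, coverMap_eq_of_isRep hr ha⟩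

/-- Near a point of the cubic curve, a regular function on the cover has the form
`(F + y T) / N`, where `N`, `F` and `T` are polynomials on the plane. -/
theorem exists_local_splitting (h : IsSmoothNormalForm l₁ l₂ l₃ g) {V : Set (hypersurface g)}
    {f : (coverMap l₁ l₂ l₃ g ⁻¹' V : Set _) → ℂ}
    (hf : f ∈ (rootCoords l₁ l₂ l₃ g).regular (coverMap l₁ l₂ l₃ g ⁻¹' V))
    {p : hypersurface g} (hp : p ∈ V) :
    ∃ (k : ℤ) (N F T : MvPolynomial (Fin 3) ℂ),
      IsWeightedHomogeneous (fun _ => (1 : ℤ)) N k ∧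
      IsWeightedHomogeneous (fun _ => (1 : ℤ)) F k ∧
      IsWeightedHomogeneous (fun _ => (1 : ℤ)) T (k - 1) ∧
      (∀ x ∈ (cubicCoords g).cone p, eval x N ≠ 0) ∧
      ∀ (z : (coverMap l₁ l₂ l₃ g ⁻¹' V : Set _)) (a : Fin 3 → ℂ) (u v y : ℂ),
        IsRep z.1 a u v y → f z * eval a N = eval a F + y * eval a T := by
  obtain ⟨a, ha⟩ := (cubicCoords_wellFormed g).nonempty p
  obtain ⟨y, hy⟩ := IsAlgClosed.exists_pow_nat_eq (eval a (l₁ * l₂ - l₃ ^ 2)) two_pos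
  obtain ⟨z₁, u₁, v₁, hr₁, hz₁⟩ := exists_fibre_points h ha hy
  obtain ⟨z₂, u₂, v₂, hr₂, hz₂⟩ := exists_fibre_points h ha (y := -y) (by rw [neg_sq, hy])
  obtain ⟨k₁, A₁, B₁, hA₁, hB₁, hB₁0, hf₁⟩ := exists_denominator hf
    ⟨z₁, by rwa [Set.mem_preimage, hz₁]⟩
  obtain ⟨k₂, A₂, B₂, hA₂, hB₂, hB₂0, hf₂⟩ := exists_denominator hf
    ⟨z₂, by rwa [Set.mem_preimage, hz₂]⟩
  obtain ⟨i, hi⟩ := Function.ne_iff.1 ha.1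
  simp only [Pi.zero_apply] at hi
  let w₁ : Fin 3 ⊕ Unit → ℂ := Sum.elim a fun _ => y
  let w₂ : Fin 3 ⊕ Unit → ℂ := Sum.elim a fun _ => -y
  let L : MvPolynomial (Fin 3 ⊕ Unit) ℂ := X (Sum.inl i)
  have hL : IsWeightedHomogeneous (fun _ => (1 : ℤ)) L 1 := isWeightedHomogeneous_X ℂ _ _
  have hL₁ : eval w₁ L ≠ 0 := by simpa [L, w₁]
  have hL₂ : eval w₂ L ≠ 0 := by simpa [L, w₂]
  -- Powers of a coordinate that is non-zero at p equalise the degrees, so that the two quotients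
  -- can be combined.
  obtain ⟨n₁, n₂, hn⟩ : ∃ n₁ n₂ : ℕ, k₁ + n₁ = k₂ + n₂ :=
    ⟨(k₂ - k₁).toNat, (k₁ - k₂).toNat, by omega⟩
  obtain ⟨c₁, c₂, hc₁, hc₂⟩ := exists_linear_combination_ne_zero
    (b := eval w₁ (B₂ * L ^ n₂)) (c := eval w₂ (B₁ * L ^ n₁))
    (show eval w₁ (B₁ * L ^ n₁) ≠ 0 by
      rw [map_mul, map_pow]
      exact mul_ne_zero (hB₁0 w₁ ⟨u₁, v₁, hr₁⟩) (pow_ne_zero _ hL₁))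
    (show eval w₂ (B₂ * L ^ n₂) ≠ 0 by
      rw [map_mul, map_pow]
      exact mul_ne_zero (hB₂0 w₂ ⟨u₂, v₂, hr₂⟩) (pow_ne_zero _ hL₂))
  have hcomb : ∀ {P₁ P₂ : MvPolynomial (Fin 3 ⊕ Unit) ℂ},
      IsWeightedHomogeneous (fun _ => (1 : ℤ)) P₁ k₁ →
      IsWeightedHomogeneous (fun _ => (1 : ℤ)) P₂ k₂ →
      IsWeightedHomogeneous (fun _ => (1 : ℤ)) (C c₁ * (P₁ * L ^ n₁) + C c₂ * (P₂ * L ^ n₂))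
        (k₁ + n₁) := by
    intro P₁ P₂ h₁ h₂
    have e₁ := h₁.mul (hL.pow n₁)
    have e₂ := h₂.mul (hL.pow n₂)
    rw [nsmul_eq_mul, mul_one] at e₁ e₂
    rw [← hn] at e₂
    exact (e₁.C_mul _).add (e₂.C_mul _)
  obtain ⟨α, β, hα, hβ, hαβ⟩ := exists_linear_in_root h (hcomb hA₁ hA₂)
  obtain ⟨γ, δ, hγ, hδ, hγδ⟩ := exists_linear_in_root h (hcomb hB₁ hB₂)
  set k := k₁ + n₁
  set s := l₁ * l₂ - l₃ ^ 2 with hs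
  have hs2 := h.isWeightedHomogeneous_conic
  -- The function now satisfies f(γ + yδ) = α + yβ. Multiplying by the conjugate γ - yδ leaves the
  -- norm γ² - δ²s as a denominator free of y.
  have hN : IsWeightedHomogeneous (fun _ => (1 : ℤ)) (γ * γ - δ * δ * s) (k + k) := by
    have := (hδ.mul hδ).mul hs2
    rw [show k - 1 + (k - 1) + 2 = k + k by ring] at this
    exact (hγ.mul hγ).sub this
  refine ⟨k + k, γ * γ - δ * δ * s, α * γ - β * δ * s, β * γ - α * δ, hN, ?_, ?_, ?_, ?_⟩
  · have := (hβ.mul hδ).mul hs2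
    rw [show k - 1 + (k - 1) + 2 = k + k by ring] at this
    exact (hα.mul hγ).sub this
  · have e₁ := hβ.mul hγ
    have e₂ := hα.mul hδ
    rw [show k - 1 + k = k + k - 1 by ring] at e₁
    rw [show k + (k - 1) = k + k - 1 by ring] at e₂
    exact e₁.sub e₂
  · intro x hx
    refine (cubicCoords_wellFormed g).eval_ne_zero ha hx hN ?_
    have e₁ := hγδ w₁ hy
    have e₂ := hγδ w₂ (by
      change (-y) ^ 2 = _
      rw [neg_sq]
      exact hy)
    simp only [map_add, map_mul, eval_C] at hc₁ hc₂ e₁ e₂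
    rw [e₁] at hc₁
    rw [e₂] at hc₂
    -- The norm at a is the product of the values of γ + yδ at the two roots over [a].
    have := mul_ne_zero hc₁ hc₂
    simp only [map_sub, map_mul]
    convert this using 1
    simp only [w₁, w₂, Sum.elim_inr, Sum.elim_comp_inl]
    linear_combination (eval a δ * eval a δ) * hy
  · intro z a u v y hr
    let w : Fin 3 ⊕ Unit → ℂ := Sum.elim a fun _ => y
    have hw : w ∈ (rootCoords l₁ l₂ l₃ g).cone z.1 := ⟨u, v, hr⟩
    have hsq := hr.sq_eq
    have e₁ := hαβ w hsq
    have e₂ := hγδ w hsq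
    have f₁ := hf₁ z w hw
    have f₂ := hf₂ z w hw
    simp only [map_add, map_mul, eval_C, map_pow] at e₁ e₂
    simp only [w, Sum.elim_inr, Sum.elim_comp_inl] at e₁ e₂ f₁ f₂
    have key : f z * (eval a γ + y * eval a δ) = eval a α + y * eval a β := by
      rw [← e₁, ← e₂, ← f₁, ← f₂]
      ring
    simp only [map_sub, map_mul]
    rw [← hs] at hsq
    linear_combination (eval a γ - y * eval a δ) * key +
      (f z * eval a δ * eval a δ - eval a β * eval a δ) * hsq

/-- A section on an open part of the cubic curve that vanishes away from the conic is zero. -/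
theorem section_eq_zero_of_diff_conic (h : IsSmoothNormalForm l₁ l₂ l₃ g)
    {V : Set (hypersurface g)} (hV : IsOpen[(cubicCoords g).zariski] V) {d : ℤ}
    {t : (cubicCoords g).ConeOver V → ℂ} (ht : t ∈ (cubicCoords g).sections d V)
    (h0 : ∀ z, eval z.2.1 (l₁ * l₂ - l₃ ^ 2) ≠ 0 → t z = 0) : t = 0 := by
  funext ⟨p, x, hx⟩
  obtain ⟨k, A, B, -, -, hB0, hAB⟩ := ht p
  have := eval_eq_zero_of_diff_conic h.hl₁ h.hl₂ h.hl₃ h.hg h.smooth hV (A * B)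
    (fun q hq y hy hs => by
      rw [map_mul]
      by_cases hB : eval y B = 0
      · rw [hB, mul_zero]
      · have e := hAB ⟨⟨q, hq⟩, y, hy⟩ hB
        rw [h0 ⟨⟨q, hq⟩, y, hy⟩ hs, eq_comm, div_eq_zero_iff] at e
        rw [e.resolve_right hB, zero_mul]) p.2 hx
  rw [map_mul] at this
  rw [hAB ⟨p, x, hx⟩ (hB0 x hx), (mul_eq_zero.1 this).resolve_right (hB0 x hx), zero_div]
  rfl

open Classical in
/-- The square root of `l₁ l₂ - l₃²` at `a` belonging to the point `z` of the cover. -/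
noncomputable def rootValue (z : coverOfCubic l₁ l₂ l₃ g) (a : Fin 3 → ℂ) : ℂ :=
  -- For a smooth normal form, `exists_isRep` excludes the default 0 on coordinate vectors of the
  -- image point.
  if h : ∃ y u v, IsRep z a u v y then h.choose else 0

theorem IsRep.rootValue_eq {z : coverOfCubic l₁ l₂ l₃ g} {a : Fin 3 → ℂ} {u v y : ℂ}
    (hr : IsRep z a u v y) : rootValue z a = y := by
  have hex : ∃ y u v, IsRep z a u v y := ⟨y, u, v, hr⟩
  rw [rootValue, dif_pos hex]
  obtain ⟨u', v', hr'⟩ := hex.choose_spec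
  exact hr.root_unique hr'

theorem rep_mem_cone (p : hypersurface g) : p.1.rep ∈ (cubicCoords g).cone p :=
  ⟨p.1.rep_nonzero, by
    rw [Projectivization.submodule_eq]
    exact Submodule.mem_span_singleton_self _⟩

theorem exists_smul_of_cone {p : hypersurface g} {x x' : Fin 3 → ℂ}
    (hx : x ∈ (cubicCoords g).cone p) (hx' : x' ∈ (cubicCoords g).cone p) :
    ∃ c : ℂˣ, x' = (c : ℂ) • x := by
  obtain ⟨c, hc⟩ := (mem_submodule_iff_of_cone hx).1 hx'.2
  have hc0 : c ≠ 0 := by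
    rintro rfl
    exact hx'.1 (by rw [hc, zero_smul])
  exact ⟨Units.mk0 c hc0, hc⟩

theorem cubic_section_smul {d : ℤ} {V : Set (hypersurface g)}
    {t : (cubicCoords g).ConeOver V → ℂ} (ht : t ∈ (cubicCoords g).sections d V) (p : V)
    (x x' : (cubicCoords g).cone p.1) {c : ℂˣ} (hc : x'.1 = (c : ℂ) • x.1) :
    t ⟨p, x'⟩ = (c : ℂ) ^ d * t ⟨p, x⟩ := by
  rw [HomCoords.sections_torus ht p x x' (c := zpowersHom ℂˣ c)]
  · simp [zpowersHom_apply]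
  · rw [hc]
    funext i
    simp [zpowersHom_apply, cubicCoords, HomCoords.restrict, HomCoords.projSpace]

/-- The product of a section of `𝒪(-1)` on the cubic curve with the square root. -/
noncomputable def mulRoot (V : Set (hypersurface g)) (t : (cubicCoords g).ConeOver V → ℂ)
    (z : (coverMap l₁ l₂ l₃ g ⁻¹' V : Set _)) : ℂ :=
  rootValue z.1 (coverMap l₁ l₂ l₃ g z.1).1.rep *
    t ⟨⟨coverMap l₁ l₂ l₃ g z.1, z.2⟩, (coverMap l₁ l₂ l₃ g z.1).1.rep, rep_mem_cone _⟩

/-- The weights 1 of y and -1 of t cancel, so the chosen representative vector does not matter. -/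
theorem mulRoot_eq (h : IsSmoothNormalForm l₁ l₂ l₃ g) {V : Set (hypersurface g)}
    {t : (cubicCoords g).ConeOver V → ℂ} (ht : t ∈ (cubicCoords g).sections (-1) V)
    (z : (coverMap l₁ l₂ l₃ g ⁻¹' V : Set _)) {a : Fin 3 → ℂ} {u v y : ℂ}
    (hr : IsRep z.1 a u v y) :
    mulRoot V t z = y * t ⟨⟨coverMap l₁ l₂ l₃ g z.1, z.2⟩, a, hr.mem_cone⟩ := by
  obtain ⟨c, hc⟩ := exists_smul_of_cone (p := coverMap l₁ l₂ l₃ g z.1) hr.mem_cone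
    (rep_mem_cone (coverMap l₁ l₂ l₃ g z.1))
  have hr' := hr.smul_point h c.ne_zero
  rw [← hc] at hr'
  have h1 := cubic_section_smul ht ⟨coverMap l₁ l₂ l₃ g z.1, z.2⟩ ⟨a, hr.mem_cone⟩
    ⟨_, rep_mem_cone (coverMap l₁ l₂ l₃ g z.1)⟩ hc
  rw [mulRoot, h1, hr'.rootValue_eq, zpow_neg_one]
  have := c.ne_zero
  field_simp

theorem mulRoot_mem_regular (h : IsSmoothNormalForm l₁ l₂ l₃ g) {V : Set (hypersurface g)}
    (hV : IsOpen[(cubicCoords g).zariski] V) {t : (cubicCoords g).ConeOver V → ℂ}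
    (ht : t ∈ (cubicCoords g).sections (-1) V) :
    mulRoot V t ∈ (coverOfCubicCoords l₁ l₂ l₃ g).regular (coverMap l₁ l₂ l₃ g ⁻¹' V) := by
  rw [mem_regular_cover_iff h hV]
  intro z
  obtain ⟨k, A, B, hA, hB, hB0, hAB⟩ := ht ⟨coverMap l₁ l₂ l₃ g z.1, z.2⟩
  refine ⟨k, rename Sum.inl A * X (Sum.inr ()), rename Sum.inl B, ?_, hB.rename_inl, ?_, ?_⟩
  · have := (IsWeightedHomogeneous.rename_inl hA).mul
      (isWeightedHomogeneous_X ℂ (fun _ => (1 : ℤ)) (Sum.inr ()))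
    rwa [show k + -1 + 1 = k + 0 by ring] at this
  · rintro w ⟨u, v, hr⟩
    rw [eval_rename]
    exact hB0 _ hr.mem_cone
  · rintro ⟨z', w, u, v, hr⟩ hw
    simp only [eval_rename, map_mul, eval_X] at hw ⊢
    rw [mulRoot_eq h ht z' hr, hAB ⟨⟨_, z'.2⟩, _, hr.mem_cone⟩ hw]
    ring

/-- Regular functions and sections of `𝒪(-1)` on the cubic curve are linearly independent on the
cover. -/
theorem splitting_injective (h : IsSmoothNormalForm l₁ l₂ l₃ g) {V : Set (hypersurface g)}
    (hV : IsOpen[(cubicCoords g).zariski] V) {f : V → ℂ} (hf : f ∈ (cubicCoords g).regular V)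
    {t : (cubicCoords g).ConeOver V → ℂ} (ht : t ∈ (cubicCoords g).sections (-1) V)
    (h0 : ∀ z : (coverMap l₁ l₂ l₃ g ⁻¹' V : Set _),
      f ⟨coverMap l₁ l₂ l₃ g z.1, z.2⟩ + mulRoot V t z = 0) : f = 0 ∧ t = 0 := by
  have key : ∀ z : (cubicCoords g).ConeOver V, eval z.2.1 (l₁ * l₂ - l₃ ^ 2) ≠ 0 →
      f z.1 = 0 ∧ t z = 0 := by
    rintro ⟨⟨p, hp⟩, x, hx⟩ hs
    obtain ⟨y, hy⟩ := IsAlgClosed.exists_pow_nat_eq (eval x (l₁ * l₂ - l₃ ^ 2)) two_pos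
    -- Both roots occur in the fibre, so f + y t = 0 = f - y t. Off the conic y ≠ 0, so f and t
    -- vanish there; density does the rest.
    have hval : ∀ y', y' ^ 2 = eval x (l₁ * l₂ - l₃ ^ 2) →
        f ⟨p, hp⟩ + y' * t ⟨⟨p, hp⟩, x, hx⟩ = 0 := by
      intro y' hy'
      obtain ⟨z, u, v, hr, rfl⟩ := exists_fibre_points h hx hy'
      have := h0 ⟨z, hp⟩
      rwa [mulRoot_eq h ht ⟨z, hp⟩ hr] at this
    have e₁ := hval y hy
    have e₂ := hval (-y) (by rw [neg_sq, hy])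
    have hy0 : y ≠ 0 := by
      rintro rfl
      exact hs (by rw [← hy]; ring)
    constructor
    · simp only
      linear_combination (e₁ + e₂) / 2
    · apply mul_left_cancel₀ hy0
      linear_combination (e₁ - e₂) / 2
  constructor
  · have := section_eq_zero_of_diff_conic h hV (d := 0) hf fun z hz => (key z hz).1
    funext p
    exact congrFun this ⟨p, _, rep_mem_cone p.1⟩
  · exact section_eq_zero_of_diff_conic h hV ht fun z hz => (key z hz).2

/-- Every regular function on the cover is the sum of a regular function on the cubic curve and a
section of `𝒪(-1)` times the square root. -/
theorem splitting_surjective (h : IsSmoothNormalForm l₁ l₂ l₃ g) {V : Set (hypersurface g)}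
    (hV : IsOpen[(cubicCoords g).zariski] V)
    {f : (coverMap l₁ l₂ l₃ g ⁻¹' V : Set _) → ℂ}
    (hf : f ∈ (coverOfCubicCoords l₁ l₂ l₃ g).regular (coverMap l₁ l₂ l₃ g ⁻¹' V)) :
    ∃ f₀ ∈ (cubicCoords g).regular V, ∃ t ∈ (cubicCoords g).sections (-1) V,
      ∀ z, f z = f₀ ⟨coverMap l₁ l₂ l₃ g z.1, z.2⟩ + mulRoot V t z := by
  rw [mem_regular_cover_iff h hV] at hf
  choose k N F T hN hF hT hN0 hNFT using fun p : V => exists_local_splitting h hf p.2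
  -- Gluing: the local triples (N, F, T) at p and q define the same F/N and T/N. Comparing y with -y
  -- shows this off the conic, and density extends it to all of V.
  have hcross : ∀ (p q : V) (x : Fin 3 → ℂ), x ∈ (cubicCoords g).cone p.1 →
      eval x (F p * N q - F q * N p) = 0 ∧ eval x (T p * N q - T q * N p) = 0 := by
    intro p q x hx
    have key : ∀ r ∈ V, ∀ x ∈ (cubicCoords g).cone r, eval x (l₁ * l₂ - l₃ ^ 2) ≠ 0 →
        eval x (F p * N q - F q * N p) = 0 ∧ eval x (T p * N q - T q * N p) = 0 := by
      intro r hr x hx hs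
      obtain ⟨y, hy⟩ := IsAlgClosed.exists_pow_nat_eq (eval x (l₁ * l₂ - l₃ ^ 2)) two_pos
      have hval : ∀ y', y' ^ 2 = eval x (l₁ * l₂ - l₃ ^ 2) →
          (eval x (F p) + y' * eval x (T p)) * eval x (N q) =
            (eval x (F q) + y' * eval x (T q)) * eval x (N p) := by
        intro y' hy'
        obtain ⟨z, u, v, hz, rfl⟩ := exists_fibre_points h hx hy'
        rw [← hNFT p ⟨z, hr⟩ x u v y' hz, ← hNFT q ⟨z, hr⟩ x u v y' hz]
        ring
      have e₁ := hval y hy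
      have e₂ := hval (-y) (by rw [neg_sq, hy])
      have hy0 : y ≠ 0 := by
        rintro rfl
        exact hs (by rw [← hy]; ring)
      simp only [map_sub, map_mul]
      constructor
      · linear_combination (e₁ + e₂) / 2
      · apply mul_left_cancel₀ hy0
        linear_combination (e₁ - e₂) / 2
    exact ⟨eval_eq_zero_of_diff_conic h.hl₁ h.hl₂ h.hl₃ h.hg h.smooth hV _
        (fun r hr x hx hs => (key r hr x hx hs).1) p.2 hx,
      eval_eq_zero_of_diff_conic h.hl₁ h.hl₂ h.hl₃ h.hg h.smooth hV _
        (fun r hr x hx hs => (key r hr x hx hs).2) p.2 hx⟩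
  have hquot : ∀ (p : V) (x : Fin 3 → ℂ), x ∈ (cubicCoords g).cone p.1 →
      eval p.1.1.rep (F p) / eval p.1.1.rep (N p) = eval x (F p) / eval x (N p) := by
    intro p x hx
    obtain ⟨c, hc⟩ := (cubicCoords_wellFormed g).torus p.1 x hx _ (rep_mem_cone p.1)
    have e₁ := IsWeightedHomogeneous.eval_torus (hF p) c x
    have e₂ := IsWeightedHomogeneous.eval_torus (hN p) c x
    have hc' : p.1.1.rep = fun i => ((c (Multiplicative.ofAdd 1) : ℂˣ) : ℂ) * x i := hc
    rw [hc', e₁, e₂, mul_div_mul_left _ _ (Units.ne_zero _)]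
  -- Each point uses its own local triple; `hcross` shows that near p the triple of p alone gives
  -- the same values.
  refine ⟨fun p => eval p.1.1.rep (F p) / eval p.1.1.rep (N p), fun p => ?_,
    fun z => eval z.2.1 (T z.1) / eval z.2.1 (N z.1), fun p => ?_, fun z => ?_⟩
  · refine ⟨k p, F p, N p, by rw [add_zero]; exact hF p, hN p, hN0 p, ?_⟩
    rintro ⟨q, x, hx⟩ hne
    simp only at hne ⊢
    rw [hquot q x hx, div_eq_div_iff (hN0 q x hx) hne]
    have := (hcross q p x hx).1
    simp only [map_sub, map_mul] at this
    linear_combination this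
  · refine ⟨k p, T p, N p, hT p, hN p, hN0 p, ?_⟩
    rintro ⟨q, x, hx⟩ hne
    simp only at hne ⊢
    rw [div_eq_div_iff (hN0 q x hx) hne]
    have := (hcross q p x hx).2
    simp only [map_sub, map_mul] at this
    linear_combination this
  · set p : V := ⟨coverMap l₁ l₂ l₃ g z.1, z.2⟩
    obtain ⟨u, v, y, hr⟩ := exists_isRep h z.1 (rep_mem_cone p.1)
    have hNz := hN0 p _ (rep_mem_cone p.1)
    have e := hNFT p z _ u v y hr
    rw [mulRoot, show rootValue z.1 _ = _ from hr.rootValue_eq]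
    change f z = eval p.1.1.rep (F p) / eval p.1.1.rep (N p) +
      y * (eval p.1.1.rep (T p) / eval p.1.1.rep (N p))
    field_simp
    linear_combination e

/-- The section `l₁ l₂ - l₃²` of `𝒪(2)` on the cubic curve. -/
noncomputable def conicSection (h : IsSmoothNormalForm l₁ l₂ l₃ g) :
    (cubicCoords g).sections (1 + 1) Set.univ :=
  ⟨fun z => eval z.2.1 (l₁ * l₂ - l₃ ^ 2), fun _ => ⟨0, l₁ * l₂ - l₃ ^ 2, 1,
    h.isWeightedHomogeneous_conic, isWeightedHomogeneous_one _ _, by simp, by simp⟩⟩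

/-- The splitting `π_* 𝒪 ≅ 𝒪 ⊕ 𝒪(-1)`. -/
noncomputable def coverSplitting (h : IsSmoothNormalForm l₁ l₂ l₃ g) :
    HomCoords.Splitting (coverOfCubicCoords l₁ l₂ l₃ g) (cubicCoords g) (coverMap l₁ l₂ l₃ g) 1
      (conicSection h) where
  φ V hV :=
    { toFun := fun t => ⟨mulRoot V t.1, mulRoot_mem_regular h hV t.2⟩
      map_add' := fun t t' => Subtype.ext (funext fun z => by
        change mulRoot V (t.1 + t'.1) z = mulRoot V t.1 z + mulRoot V t'.1 z
        simp only [mulRoot, Pi.add_apply]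
        ring)
      map_smul' := fun c t => Subtype.ext (funext fun z => by
        change mulRoot V (c • t.1) z = c * mulRoot V t.1 z
        simp only [mulRoot, Pi.smul_apply, smul_eq_mul]
        ring) }
  restriction V W hV hW hWV t t' htt z := by
    change mulRoot W t'.1 z = mulRoot V t.1 _
    rw [mulRoot, htt]
    rfl
  linear V hV f t t' htt z := by
    change mulRoot V t'.1 z = _ * mulRoot V t.1 z
    rw [mulRoot, htt, mulRoot]
    ring
  mul V hV t t' z x := by
    obtain ⟨x, hx⟩ := x
    obtain ⟨u, v, y, hr⟩ := exists_isRep h z.1 hx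
    change mulRoot V t.1 z * mulRoot V t'.1 z = eval x (l₁ * l₂ - l₃ ^ 2) * _ * _
    rw [mulRoot_eq h t.2 z hr, mulRoot_eq h t'.2 z hr, ← hr.sq_eq]
    ring
  bijective V hV f hf := by
    obtain ⟨f₀, hf₀, t, ht, he⟩ := splitting_surjective h hV hf
    refine ⟨(⟨f₀, hf₀⟩, ⟨t, ht⟩), he, ?_⟩
    rintro ⟨⟨f₁, hf₁⟩, ⟨t₁, ht₁⟩⟩ he₁
    obtain ⟨e₁, e₂⟩ := splitting_injective h hV (((cubicCoords g).regular V).sub_mem hf₁ hf₀)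
      (((cubicCoords g).sections (-1) V).sub_mem ht₁ ht) fun z => by
        have h₁ : f z = f₁ _ + mulRoot V t₁ z := he₁ z
        have h₂ := he z
        simp only [mulRoot, Pi.sub_apply] at h₁ h₂ ⊢
        linear_combination h₂ - h₁
    exact Prod.ext (Subtype.ext (sub_eq_zero.1 e₁)) (Subtype.ext (sub_eq_zero.1 e₂))

end DirectImage

/-! ### The double cover and its branch points -/

section DoubleCover

variable {l₁ l₂ l₃ g : MvPolynomial (Fin 3) ℂ}

/-- The section `1 / xᵢ` of `𝒪(-1)` on the chart where `xᵢ` does not vanish. -/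
theorem inv_coord_mem_sections (g : MvPolynomial (Fin 3) ℂ) (i : Fin 3) :
    (fun z : (cubicCoords g).ConeOver (cubicChart g i) => (z.2.1 i)⁻¹) ∈
      (cubicCoords g).sections (-1) (cubicChart g i) := fun p =>
  ⟨1, 1, X i, by simpa using isWeightedHomogeneous_one ℂ _, isWeightedHomogeneous_X ℂ _ i, p.2,
    by simp⟩

/-- On the chart xᵢ ≠ 0 the section 1/xᵢ trivialises 𝒪(-1), so the splitting makes 1 and y/xᵢ a
basis of the direct image. -/
theorem isDoubleCover_coverMap (h : IsSmoothNormalForm l₁ l₂ l₃ g) :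
    HomCoords.IsDoubleCover (coverOfCubicCoords l₁ l₂ l₃ g) (cubicCoords g)
      (coverMap l₁ l₂ l₃ g) := by
  refine ⟨isMorphism_coverMap h, fun p => ?_⟩
  obtain ⟨i, hi⟩ := Function.ne_iff.1 p.1.rep_nonzero
  have hV := isOpen_cubicChart g i
  have ht₀ := inv_coord_mem_sections g i
  have hmul : ∀ (b : cubicChart g i → ℂ) (z),
      mulRoot (l₁ := l₁) (l₂ := l₂) (l₃ := l₃) (cubicChart g i) (fun w => b w.1 * (w.2.1 i)⁻¹) z =
        b ⟨coverMap l₁ l₂ l₃ g z.1, z.2⟩ * mulRoot (cubicChart g i) (fun w => (w.2.1 i)⁻¹) z := by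
    intro b z
    simp only [mulRoot]
    ring
  refine ⟨cubicChart g i, (mem_cubicChart_iff (rep_mem_cone p)).2 hi, hV,
    isAffine_cubicChart h.hg i, isAffine_coverChart h i, 1,
    ((coverOfCubicCoords l₁ l₂ l₃ g).regular _).one_mem,
    _, mulRoot_mem_regular h hV ht₀, fun f hf => ?_⟩
  obtain ⟨f₀, hf₀, t, ht, he⟩ := splitting_surjective h hV hf
  have hinv : ∀ (q : cubicChart g i) (x) (hx : x ∈ (cubicCoords g).cone q.1),
      t ⟨q, _, rep_mem_cone q.1⟩ * q.1.1.rep i = t ⟨q, x, hx⟩ * x i := by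
    intro q x hx
    obtain ⟨c, hc⟩ := exists_smul_of_cone hx (rep_mem_cone q.1)
    have h1 := cubic_section_smul ht q ⟨x, hx⟩ ⟨_, rep_mem_cone q.1⟩ hc
    have h2 := congrFun hc i
    simp only [Pi.smul_apply, smul_eq_mul] at h2
    rw [h1, h2, zpow_neg_one]
    have := c.ne_zero
    field_simp
  have hx0 : ∀ (q : cubicChart g i) (x) (_ : x ∈ (cubicCoords g).cone q.1), x i ≠ 0 :=
    fun q x hx => (mem_cubicChart_iff hx).1 q.2
  -- The coefficient of y/xᵢ is t xᵢ, which has degree zero and hence is a function on points.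
  let b : cubicChart g i → ℂ := fun q => t ⟨q, _, rep_mem_cone q.1⟩ * q.1.1.rep i
  have hb : b ∈ (cubicCoords g).regular (cubicChart g i) := by
    intro q
    obtain ⟨k, A, B, hA, hB, hB0, hAB⟩ := ht q
    refine ⟨k, A * X i, B, ?_, hB, hB0, ?_⟩
    · have := hA.mul (isWeightedHomogeneous_X ℂ (cubicCoords g).wt i)
      rwa [show k + -1 + (cubicCoords g).wt i = k + 0 by
        rw [show (cubicCoords g).wt i = 1 from rfl]; ring] at this
    · rintro ⟨r, x, hx⟩ hne
      change t ⟨r, _, rep_mem_cone r.1⟩ * r.1.1.rep i = _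
      rw [hinv r x hx, hAB ⟨r, x, hx⟩ hne, map_mul, eval_X]
      ring
  have hbt : t = fun w => b w.1 * (w.2.1 i)⁻¹ := by
    funext ⟨q, x, hx⟩
    have := hx0 q x hx
    simp only [b]
    rw [hinv q x hx]
    field_simp
  refine ⟨(⟨f₀, hf₀⟩, ⟨b, hb⟩), fun z => ?_, ?_⟩
  · rw [he z, hbt, hmul]
    simp
  · rintro ⟨⟨f₁, hf₁⟩, ⟨b₁, hb₁⟩⟩ he₁
    obtain ⟨e₁, e₂⟩ := splitting_injective h hV
      (((cubicCoords g).regular _).sub_mem hf₁ hf₀)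
      (HomCoords.mul_mem_sections (((cubicCoords g).regular _).sub_mem hb₁ hb) ht₀) fun z => by
        have h₁ := he₁ z
        have h₂ := he z
        rw [hbt, hmul] at h₂
        rw [hmul]
        simp only [Pi.sub_apply, Pi.one_apply, mul_one] at h₁ h₂ ⊢
        linear_combination h₂ - h₁
    refine Prod.ext (Subtype.ext (sub_eq_zero.1 e₁)) (Subtype.ext (funext fun q => ?_))
    have := congrFun e₂ ⟨q, _, rep_mem_cone q.1⟩
    simp only [Pi.sub_apply, Pi.zero_apply] at this
    exact sub_eq_zero.1 ((mul_eq_zero.1 this).resolve_right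
      (inv_ne_zero (hx0 q _ (rep_mem_cone q.1))))

/-- The fibre over [x] consists of the points belonging to y and -y with y² = s(x), and these
coincide exactly when y = 0. -/
theorem branchLocus_coverMap (h : IsSmoothNormalForm l₁ l₂ l₃ g) :
    branchLocus (coverMap l₁ l₂ l₃ g) = {p | p.1 ∈ hypersurface (l₁ * l₂ - l₃ ^ 2)} := by
  have hQ : (l₁ * l₂ - l₃ ^ 2).IsHomogeneous 2 := (h.hl₁.mul h.hl₂).sub (h.hl₃.pow 2)
  ext p
  have hx := rep_mem_cone p
  set x := p.1.rep
  rw [Set.mem_ofPred_eq, mem_hypersurface_iff hQ hx, branchLocus, Set.mem_ofPred_eq, not_iff_comm]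
  obtain ⟨y, hy⟩ := IsAlgClosed.exists_pow_nat_eq (eval x (l₁ * l₂ - l₃ ^ 2)) two_pos
  obtain ⟨z₁, u₁, v₁, hr₁, hz₁⟩ := exists_fibre_points h hx hy
  obtain ⟨z₂, u₂, v₂, hr₂, hz₂⟩ := exists_fibre_points h hx (y := -y) (by rw [neg_sq, hy])
  have hfib : coverMap l₁ l₂ l₃ g ⁻¹' {p} = {z₁, z₂} := by
    ext z
    rw [Set.mem_preimage, Set.mem_singleton_iff, Set.mem_insert_iff, Set.mem_singleton_iff]
    constructor
    · rintro rfl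
      obtain ⟨u, v, y', hr⟩ := exists_isRep h z hx
      have : y' ^ 2 = y ^ 2 := by rw [hr.sq_eq, hy]
      rcases sq_eq_sq_iff_eq_or_eq_neg.1 this with rfl | rfl
      · exact Or.inl (hr₁.point_unique h hr)
      · exact Or.inr (hr₂.point_unique h hr)
    · rintro (rfl | rfl)
      · exact hz₁
      · exact hz₂
  rw [hfib]
  constructor
  · intro hs
    refine Set.ncard_pair fun e => ?_
    subst e
    have hyy := hr₁.root_unique hr₂
    have hy0 : y = 0 := by linear_combination (-1 / 2 : ℂ) * hyy
    exact hs (by rw [← hy, hy0]; ring)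
  · intro hcard hs
    have hy0 : y = 0 := by
      rw [hs] at hy
      exact pow_eq_zero_iff two_ne_zero |>.1 hy
    rw [hy0, neg_zero] at hr₂
    rw [hy0] at hr₁
    rw [hr₁.point_unique h hr₂, Set.pair_eq_singleton, Set.ncard_singleton] at hcard
    omega

end DoubleCover

theorem mainTheorem9 (l₁ l₂ l₃ g : MvPolynomial (Fin 3) ℂ)
    (hl₁ : l₁.IsHomogeneous 1) (hl₂ : l₂.IsHomogeneous 1) (hl₃ : l₃.IsHomogeneous 1)
    (hg : g.IsHomogeneous 3) (hX : IsSmoothHypersurface (threefoldEq l₁ l₂ l₃ g)) :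
    IsSmoothHypersurface g ∧
    discriminantCurve l₁ l₂ l₃ g = hypersurface g ∪ hypersurface (l₁ * l₂ - l₃ ^ 2) ∧
    HomCoords.IsDoubleCover (coverOfCubicCoords l₁ l₂ l₃ g) (cubicCoords g)
      (coverMap l₁ l₂ l₃ g) ∧
    branchLocus (coverMap l₁ l₂ l₃ g) = {p | p.1 ∈ hypersurface (l₁ * l₂ - l₃ ^ 2)} ∧
    ∃ s : (cubicCoords g).sections (1 + 1) Set.univ,
      (∀ z, s.1 z = MvPolynomial.eval z.2.1 (l₁ * l₂ - l₃ ^ 2)) ∧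
      HomCoords.IsAssociatedWith (coverOfCubicCoords l₁ l₂ l₃ g) (cubicCoords g)
        (coverMap l₁ l₂ l₃ g) 1 s :=
  have h : IsSmoothNormalForm l₁ l₂ l₃ g := ⟨hl₁, hl₂, hl₃, hg, hX⟩
  ⟨isSmoothHypersurface_cubic hX, discriminantCurve_eq h, isDoubleCover_coverMap h,
    branchLocus_coverMap h, conicSection h, fun _ => rfl, ⟨coverSplitting h⟩⟩
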